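/- **Setting.** Let $M\subseteq\mathbb R^N$ be a $N$-dimensional configuration manifold (an open subset of $\mathbb R^N$) and consider the driftless control-affine system $\Sigma$: $\dot x=\sum_{i=1}^m u_i\,g_i(x)$, with $g_1,\dots,g_m$ smooth vector fields on $M$ and controls $u\in U$, where $U\subset\mathbb R^m$ is closed, bounded, symmetric about $0$, and $0$ is interior to the convex hull of $U$. A trajectory is a continuous $x:[0,T]\to M$ generated by a measurable control $u:[0,T]\to U$; its cost is its Euclidean arc length $\ell(x)=\int_0^T\|\dot x\|\,dt$. Let $d(p,q)\in[0,\infty]$ be the infimum of the lengths of the trajectories from $p$ to $q$. Let $L^k(x)\subseteq\mathbb R^N$ be the span at $x$ of the iterated Lie brackets of the $g_i$ with at most $k$ terms, $n_k(x)=\dim L^k(x)$, $w_i(x)=\min\{k: i\le n_k(x)\}$ for $1\le i\le N$, and $s(x)=\min\{k:L^k(x)=\mathbb R^N\}$. For each $x_0\in M$ fix privileged coordinates $z_1,\dots,z_N$ at $x_0$: $z_i=y_i+\mathrm{poly}_i(y_1,\dots,y_{i-1})$, where $y$ are the linear coordinates, centred at $x_0$, of an orthonormal basis adapted to the flag $L^1(x_0)\subseteq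 L^2(x_0)\subseteq\cdots$, $\mathrm{poly}_i$ has only terms of degree $\ge 2$ and $<w_i(x_0)$, and all iterated derivatives of $z_i$ along fewer than $w_i(x_0)$ of the $g_j$ vanish at $x_0$. Put $\|x\|_{x_0}=\max_i|z_i(x)|^{1/w_i(x_0)}$. **Assumptions $A_\Sigma$.** (a) $\bigcup_k L^k(x)=\mathbb R^N$ for all $x\in M$. (b) Every $x\in M$ has a neighbourhood on which all $n_k$ are constant. (c) There are constants $0<a_{\min}\le A_{\max}$ and $\sigma_{\min}>0$ such that $a_{\min}\|x\|_{x_0}\le d(x_0,x)\le A_{\max}\|x\|_{x_0}$ for all $x_0,x\in M$ with $d(x_0,x)<\sigma_{\min}$. (d) There is $\theta_{\min}>0$ such that $\|x_0-x\|\le d(x_0,x)\le 2A_{\max}\|x_0-x\|^{1/s(x_0)}$ for all $x_0,x\in M$ with $\|x_0-x\|\le\theta_{\min}$. **Planning problem.** Let $M_{\rm obs}\subseteq M$ with $M\setminus M_{\rm obs}$ open, let $M_{\rm free}$ be the closure of $M\setminus M_{\rm obs}$ in $M$, of finite Lebesgue measure $\mu(M_{\rm free})$, let $x_{\rm init}\in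 M_{\rm free}$, and let $M_{\rm goal}\subseteq M_{\rm free}$ be relatively open. Let $D=\sum_i w_i(x_{\rm init})$ (the same number at every point if $M$ is connected). A trajectory is collision-free if it stays in $M_{\rm free}$, and feasible if moreover it starts at $x_{\rm init}$ and ends in $\overline{M_{\rm goal}}$. A collision-free trajectory has strong $\delta$-clearance if all its points have Euclidean distance at least $\delta$ from every point of $M_{\rm obs}$. It has weak $\delta$-clearance if there is a homotopy $\psi$ with fixed endpoints from $\psi(0)=x$ to a trajectory $\psi(1)$ with strong $\delta$-clearance such that, for each $\alpha\in(0,1]$, $\psi(\alpha)$ is a trajectory with strong $\delta_\alpha$-clearance for some $\delta_\alpha>0$, and $\ell(\psi(\alpha))\to\ell(x)$ as $\alpha\to0^+$. The goal is $\xi$-regular if for every $y\in\partial M_{\rm goal}$ (boundary in $M$) there is $z\in M_{\rm goal}$ such that the open Euclidean ball of radius $\xi$ about $z$ lies in $M_{\rm goal}$ and $\|y-z\|=\xi$. **DPRM*.** For some pairs $(p,q)$ of points of $M$, including, locally uniformly, all pairs of sufficiently close points, a steering procedure provides an edge $(p,q)$: a trajectory from $p$ to $q$ of minimal length $d(p,q)$,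 neglecting obstacles. $\mathrm{CollisionFree}(p,q)$ holds if the edge $(p,q)$ is provided and does not meet $M_{\rm obs}$. Given a sample size $n$ and a radius $r$, let $V$ consist of $x_{\rm init}$ and $n$ independent uniformly distributed points of $M_{\rm free}$, and let $G$ be the undirected graph on $V$ with the edges $\{u,v\}$, $u\neq v$, such that, for one of the two orders of $u$ and $v$, $\|u\|_v<r/a_{\min}$ and $\mathrm{CollisionFree}(u,v)$. The algorithm returns a path in $G$ from $x_{\rm init}$ to a vertex in $V\cap M_{\rm goal}$ of minimal cost, the cost of a path being the sum of $d(u,v)$ over its edges; the cost is $\infty$ if there is no such path (failure). **Corollary (DPRM* asymptotic optimality).** Under the assumptions $A_\Sigma$, suppose that $M_{\rm goal}$ is $\xi$-regular for some $\xi>0$, that $x_{\rm init}\notin\overline{M_{\rm goal}}\setminus M_{\rm goal}$, and that there is a feasible trajectory $x^*$ of minimal cost $c^*=\ell(x^*)$ among all feasible trajectories which has weak $\delta$-clearance for some $\delta>0$. Let $\eta\ge0$ and let $c_n$ be the cost of the path returned by DPRM* with $n$ samples and the radius $$r_n=4A_{\max}(1+\eta)^{1/D}\left(\frac{\mu(M_{\rm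 free})}{D}\right)^{1/D}\left(\frac{\log n}{n}\right)^{1/D}.$$ Then for every fixed $\varepsilon>0$, as $n\to\infty$, $$\mathbb P\bigl(c_n>(1+\varepsilon)c^*\bigr)=O\bigl(n^{-\eta/D}\,\log^{-1/D}n\bigr).$$ -/

import Mathlib

open MeasureTheory Filter Topology Asymptotics

noncomputable section

namespace DPRM

/-- The ambient Euclidean space `ℝᵈ`. -/
abbrev Euc (d : ℕ) : Type := EuclideanSpace ℝ (Fin d)

/-- A driftless control-affine system `ẋ = ∑ i, uᵢ gᵢ(x)`, `u ∈ U`, on a `d`-dimensional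
configuration manifold `M ⊆ ℝᵈ` (that is, on an open subset of `ℝᵈ`). -/
structure DCASystem (d m : ℕ) where
  /-- the configuration manifold -/
  M : Set (Euc d)
  /-- the control vector fields -/
  g : Fin m → Euc d → Euc d
  /-- the control set -/
  U : Set (Fin m → ℝ)
  isOpen_M : IsOpen M
  smooth_g : ∀ i, ContDiffOn ℝ ((⊤ : ℕ∞) : WithTop ℕ∞) (g i) M
  isClosed_U : IsClosed U
  isBounded_U : Bornology.IsBounded U
  symm_U : ∀ u ∈ U, -u ∈ U
  zero_mem : (0 : Fin m → ℝ) ∈ interior (convexHull ℝ U)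

variable {d m : ℕ}

/-- A dynamically feasible trajectory `x : [0,T] → M`, with a measurable control `u : [0,T] → U`
generating it (the differential equation is written in its integral form). -/
structure Trajectory (S : DCASystem d m) where
  T : ℝ
  T_nonneg : 0 ≤ T
  x : ℝ → Euc d
  u : ℝ → Fin m → ℝ
  continuousOn_x : ContinuousOn x (Set.Icc 0 T)
  x_mem : ∀ t ∈ Set.Icc 0 T, x t ∈ S.M
  measurable_u : Measurable u
  u_mem : ∀ t ∈ Set.Icc 0 T, u t ∈ S.U
  ode : ∀ t ∈ Set.Icc 0 T, x t = x 0 + ∫ s in (0 : ℝ)..t, ∑ i, u s i • S.g i (x s)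

namespace Trajectory

variable {S : DCASystem d m}

/-- The velocity `ẋ(t) = ∑ i, uᵢ(t) gᵢ(x(t))`. -/
def velocity (τ : Trajectory S) (t : ℝ) : Euc d := ∑ i, τ.u t i • S.g i (τ.x t)

/-- The arc length `ℓ(x) = ∫₀ᵀ ‖ẋ(t)‖ dt`. -/
def length (τ : Trajectory S) : ℝ := ∫ t in (0 : ℝ)..τ.T, ‖τ.velocity t‖

/-- The trajectory leads from `p` to `q`. -/
def Joins (τ : Trajectory S) (p q : Euc d) : Prop := τ.x 0 = p ∧ τ.x τ.T = q

end Trajectory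

namespace DCASystem

/-- The sub-Riemannian distance, `∞` if no trajectory connects the points. -/
def sdist (S : DCASystem d m) (p q : Euc d) : ENNReal :=
  ⨅ (τ : Trajectory S) (_ : τ.Joins p q), ENNReal.ofReal τ.length

/-- The flag of distributions: `ℒ¹ = span (g₁,…,gₘ)`, `ℒᵏ⁺¹ = ℒᵏ + [ℒ¹, ℒᵏ]` (and `ℒ⁰ = 0`). -/
def lieFlag (S : DCASystem d m) : ℕ → Submodule ℝ (Euc d → Euc d)
  | 0 => ⊥
  | 1 => Submodule.span ℝ (Set.range S.g)
  | (k + 2) => S.lieFlag (k + 1) ⊔ Submodule.span ℝ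
      {W | ∃ Y ∈ Submodule.span ℝ (Set.range S.g), ∃ Z ∈ S.lieFlag (k + 1),
        W = VectorField.lieBracket ℝ Y Z}

/-- The subspace `Lᵏ(x)` of the tangent space at `x`. -/
def flagAt (S : DCASystem d m) (k : ℕ) (x : Euc d) : Submodule ℝ (Euc d) :=
  (S.lieFlag k).map (LinearMap.proj x)

/-- The growth vector, `n_k(x) = dim Lᵏ(x)`. -/
def growth (S : DCASystem d m) (k : ℕ) (x : Euc d) : ℕ := Module.finrank ℝ (S.flagAt k x)

/-- The weight `wᵢ` at `x` (with `i` counted from `0`): the least `k` with `i < n_k(x)`. This is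
the least `k` with `Yᵢ ∈ Lᵏ(x)` for a basis `Y₀, Y₁, …` adapted to the flag at `x`. -/
def weight (S : DCASystem d m) (x : Euc d) (i : Fin d) : ℕ := sInf {k | (i : ℕ) < S.growth k x}

/-- `s(x)`: the least `k` with `Lᵏ(x) = T_x M`. -/
def degree (S : DCASystem d m) (x : Euc d) : ℕ := sInf {k | S.flagAt k x = ⊤}

/-- `D = ∑ wᵢ`, the homogeneous dimension at `x`. When all points are regular it is locally
constant, hence independent of `x` if `M` is connected. -/
def homDim (S : DCASystem d m) (x : Euc d) : ℕ := ∑ i, S.weight x i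

/-- Iterated derivative `g_{i₁} (g_{i₂} (⋯ f))` of a function along a word in the vector fields. -/
def wordDeriv (S : DCASystem d m) (f : Euc d → ℝ) : List (Fin m) → Euc d → ℝ
  | [] => f
  | i :: l => fun x => fderiv ℝ (S.wordDeriv f l) x (S.g i x)

end DCASystem

/-- A system of privileged coordinates at `x₀`: linear coordinates `y` with respect to an orthonormal
basis of `T_{x₀} M` adapted to the flag, followed by a triangular polynomial change of coordinates
`zᵢ = yᵢ + polyᵢ(y₁,…,yᵢ₋₁)` with terms of degree `≥ 2` and `< wᵢ` only, such that `zᵢ` vanishes to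
nonholonomic order `wᵢ` at `x₀`. -/
structure PrivilegedCoords (S : DCASystem d m) (x₀ : Euc d) where
  frame : OrthonormalBasis (Fin d) ℝ (Euc d)
  adapted : ∀ k, Submodule.span ℝ (frame '' {i | (i : ℕ) < S.growth k x₀}) = S.flagAt k x₀
  poly : Fin d → MvPolynomial (Fin d) ℝ
  triangular : ∀ i, ∀ α ∈ (poly i).support, ∀ j, i ≤ j → α j = 0
  poly_degree : ∀ i, ∀ α ∈ (poly i).support, 2 ≤ α.degree ∧ α.degree < S.weight x₀ i
  order : ∀ i, ∀ l : List (Fin m), l.length < S.weight x₀ i →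
    S.wordDeriv (fun x => inner ℝ (frame i) (x - x₀) +
      MvPolynomial.eval (fun j => inner ℝ (frame j) (x - x₀)) (poly i)) l x₀ = 0

namespace PrivilegedCoords

variable {S : DCASystem d m} {x₀ : Euc d}

/-- The linear coordinates `y`. -/
def y (c : PrivilegedCoords S x₀) (x : Euc d) (i : Fin d) : ℝ := inner ℝ (c.frame i) (x - x₀)

/-- The privileged coordinates `z`. -/
def z (c : PrivilegedCoords S x₀) (x : Euc d) (i : Fin d) : ℝ :=
  c.y x i + MvPolynomial.eval (c.y x) (c.poly i)

/-- The pseudonorm `‖z(x)‖_{x₀} = maxᵢ |zᵢ(x)|^{1/wᵢ}`. -/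
def pseudonorm (c : PrivilegedCoords S x₀) (x : Euc d) : ℝ :=
  ⨆ i, |c.z x i| ^ (1 / (S.weight x₀ i : ℝ))

end PrivilegedCoords

/-- A choice of privileged coordinates at every point of the configuration manifold. -/
abbrev CoordSystem (S : DCASystem d m) : Type := ∀ p : S.M, PrivilegedCoords S (p : Euc d)

/-- The assumptions `A_Σ` on the system, with the constants occurring in them: bracket generation,
regularity of all points, the uniform ball-box inequality, the uniform distance comparison. -/
structure SystemAssumptions (S : DCASystem d m) (Z : CoordSystem S)
    (aMin aMax σMin θMin : ℝ) : Prop where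
  bracketGenerating : ∀ x ∈ S.M, ⨆ k, S.flagAt k x = ⊤
  regular : ∀ x ∈ S.M, ∀ᶠ y in 𝓝 x, ∀ k, S.growth k y = S.growth k x
  aMin_pos : 0 < aMin
  aMin_le : aMin ≤ aMax
  σMin_pos : 0 < σMin
  θMin_pos : 0 < θMin
  ballBox : ∀ x₀ : S.M, ∀ x ∈ S.M, S.sdist x₀ x < ENNReal.ofReal σMin →
    ENNReal.ofReal (aMin * (Z x₀).pseudonorm x) ≤ S.sdist x₀ x ∧
      S.sdist x₀ x ≤ ENNReal.ofReal (aMax * (Z x₀).pseudonorm x)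
  distComparison : ∀ x₀ ∈ S.M, ∀ x ∈ S.M, ‖x₀ - x‖ ≤ θMin →
    ENNReal.ofReal ‖x₀ - x‖ ≤ S.sdist x₀ x ∧
      S.sdist x₀ x ≤ ENNReal.ofReal (2 * aMax * ‖x₀ - x‖ ^ (1 / (S.degree x₀ : ℝ)))

/-- A trajectory planning problem for the system `S`. -/
structure PlanningProblem (S : DCASystem d m) where
  /-- the obstacle region -/
  obs : Set (Euc d)
  /-- the initial configuration -/
  init : Euc d
  /-- the goal region -/
  goal : Set (Euc d)
  obs_subset : obs ⊆ S.M
  isOpen_diff : IsOpen (S.M \ obs)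
  init_mem : init ∈ closure (S.M \ obs) ∩ S.M
  goal_subset : goal ⊆ closure (S.M \ obs) ∩ S.M
  goal_open : ∃ O, IsOpen O ∧ goal = O ∩ (closure (S.M \ obs) ∩ S.M)

namespace PlanningProblem

variable {S : DCASystem d m}

/-- The obstacle-free space: the closure of `M \ M_obs` in `M`. -/
def free (P : PlanningProblem S) : Set (Euc d) := closure (S.M \ P.obs) ∩ S.M

/-- Collision-free trajectories. -/
def IsCollisionFree (P : PlanningProblem S) (τ : Trajectory S) : Prop :=
  ∀ t ∈ Set.Icc 0 τ.T, τ.x t ∈ P.free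

/-- Feasible trajectories of the planning problem. -/
def IsFeasible (P : PlanningProblem S) (τ : Trajectory S) : Prop :=
  P.IsCollisionFree τ ∧ τ.x 0 = P.init ∧ τ.x τ.T ∈ closure P.goal

/-- Feasible trajectories of minimal cost. -/
def IsOptimal (P : PlanningProblem S) (τ : Trajectory S) : Prop :=
  P.IsFeasible τ ∧ ∀ τ', P.IsFeasible τ' → τ.length ≤ τ'.length

/-- Strong `δ`-clearance: the collision-free path lies in the `δ`-interior of the free space. -/
def StrongClearance (P : PlanningProblem S) (δ : ℝ) (τ : Trajectory S) : Prop :=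
  P.IsCollisionFree τ ∧ ∀ t ∈ Set.Icc 0 τ.T, ∀ a ∈ P.obs, δ ≤ dist (τ.x t) a

/-- Weak `δ`-clearance. The homotopy `ψ` has fixed endpoints, and paths of different durations are
compared after rescaling time linearly to `[0,1]`. -/
def WeakClearance (P : PlanningProblem S) (δ : ℝ) (τ : Trajectory S) : Prop :=
  P.IsCollisionFree τ ∧ ∃ ψ : ℝ → Trajectory S,
    ψ 0 = τ ∧ P.StrongClearance δ (ψ 1) ∧
    ContinuousOn (fun q : ℝ × ℝ => (ψ q.1).x (q.2 * (ψ q.1).T))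
      (Set.Icc 0 1 ×ˢ Set.Icc 0 1) ∧
    (∀ α ∈ Set.Icc (0 : ℝ) 1, (ψ α).Joins (τ.x 0) (τ.x τ.T)) ∧
    Tendsto (fun α => (ψ α).length) (𝓝[>] 0) (𝓝 τ.length) ∧
    ∀ α ∈ Set.Ioc (0 : ℝ) 1, ∃ δα > 0, P.StrongClearance δα (ψ α)

/-- `ξ`-regularity of the goal: every boundary point of the goal (boundary relative to `M`) lies on
the boundary sphere of an open Euclidean ball of radius `ξ` contained in the goal. -/
def GoalRegular (P : PlanningProblem S) (ξ : ℝ) : Prop :=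
  ∀ y ∈ frontier P.goal ∩ S.M, ∃ z ∈ P.goal, Metric.ball z ξ ⊆ P.goal ∧ dist y z = ξ

end PlanningProblem

/-- A local steering procedure: `edge p q`, when it is defined, is an optimal trajectory from `p` to
`q` neglecting obstacles; it is defined at least whenever `p` and `q` are close enough to each
other, locally uniformly. -/
structure Steering (S : DCASystem d m) where
  edge : Euc d → Euc d → Option (Trajectory S)
  optimal : ∀ p q τ, edge p q = some τ →
    τ.Joins p q ∧ ∀ τ' : Trajectory S, τ'.Joins p q → τ.length ≤ τ'.length
  local_defined : ∀ o ∈ S.M, ∃ ρ > 0, ∀ p ∈ S.M ∩ Metric.ball o ρ, ∀ q ∈ S.M ∩ Metric.ball o ρ,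
    ∃ τ, edge p q = some τ

section Algorithm

variable {S : DCASystem d m}

/-- `CollisionFree(p, q)`: the edge from `p` to `q` does not intersect an obstacle. -/
def CollisionFree (P : PlanningProblem S) (E : Steering S) (p q : Euc d) : Prop :=
  ∃ τ, E.edge p q = some τ ∧ ∀ t ∈ Set.Icc 0 τ.T, τ.x t ∉ P.obs

/-- `Near(V, x, r) = {v ∈ V : ‖v‖_x < r / a_min}`. -/
def Near (Z : CoordSystem S) (aMin : ℝ) (V : Set (Euc d)) (x : Euc d) (r : ℝ) : Set (Euc d) :=
  {v | v ∈ V ∧ ∃ hx : x ∈ S.M, (Z ⟨x, hx⟩).pseudonorm v < r / aMin}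

/-- The roadmap built by DPRM* on the vertex set `V` with radius `r`: the undirected edges `{u, v}`
with `v ∈ V`, `u ∈ Near(V \ {v}, v, r)` and `CollisionFree(u, v)`. -/
def roadmap (P : PlanningProblem S) (Z : CoordSystem S) (E : Steering S) (aMin : ℝ)
    (V : Set (Euc d)) (r : ℝ) : SimpleGraph (Euc d) :=
  SimpleGraph.fromRel fun v u => v ∈ V ∧ u ∈ Near Z aMin (V \ {v}) v r ∧ CollisionFree P E u v

/-- The cost of a path in a graph whose edges are optimal trajectories: the sum of the
sub-Riemannian lengths of its edges. -/
def walkCost (S : DCASystem d m) {G : SimpleGraph (Euc d)} {p q : Euc d} (w : G.Walk p q) :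
    ENNReal :=
  (w.darts.map fun e => S.sdist e.fst e.snd).sum

/-- `Cost(v, G)`: the cost of the shortest path in `G` from the initial state to `v`
(`∞` if there is none). -/
def graphCost (P : PlanningProblem S) (G : SimpleGraph (Euc d)) (v : Euc d) : ENNReal :=
  ⨅ w : G.Walk P.init v, walkCost S w

/-- The vertex set `{x_init} ∪ {ω₀, …, ωₙ₋₁}`. -/
def vertices (P : PlanningProblem S) {n : ℕ} (ω : Fin n → Euc d) : Set (Euc d) :=
  insert P.init (Set.range ω)

/-- The cost of the path returned by DPRM* with samples `ω` and radius `r`: the minimum of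
`Cost(v, G)` over the vertices `v` in the goal region, `∞` if the algorithm reports failure. -/
def dprmCost (P : PlanningProblem S) (Z : CoordSystem S) (E : Steering S) (aMin r : ℝ)
    {n : ℕ} (ω : Fin n → Euc d) : ENNReal :=
  ⨅ v ∈ vertices P ω ∩ P.goal, graphCost P (roadmap P Z E aMin (vertices P ω) r) v

/-- The law of `SampleFree(n)`: `n` independent uniformly distributed points of the free space. -/
def sampleFree (P : PlanningProblem S) (n : ℕ) : Measure (Fin n → Euc d) :=
  Measure.pi fun _ => ProbabilityTheory.cond (volume : Measure (Euc d)) P.free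

/-- The connection radius `rₙ`, where `D` is the homogeneous dimension. -/
def radius (P : PlanningProblem S) (aMax η : ℝ) (n : ℕ) : ℝ :=
  4 * aMax * (1 + η) ^ (1 / (S.homDim P.init : ℝ)) *
    ((volume P.free).toReal / S.homDim P.init) ^ (1 / (S.homDim P.init : ℝ)) *
    (Real.log n / n) ^ (1 / (S.homDim P.init : ℝ))

end Algorithm

end DPRM

end

open MeasureTheory Filter Topology Asymptotics

/-! The optimal trajectory need not keep away from obstacles, but weak clearance supplies a strongly
clear trajectory of length below `(1 + ε) c*` with the same endpoints. A short extra piece carries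
its end inside the goal. The resulting reference trajectory `γ`, of length `L`, has uniform room `κ`
around it and leaves a gap `g = (1 + ε) c* - L > 0` (`exists_reference_trajectory`).

Cut `γ` into about `2L/r` points at sub-Riemannian spacing at most `r/2`. A sample within `r/4` of
each point yields hops shorter than `r`, which are edges of the roadmap (`eq_or_roadmap_adj`,
`dprmCost_le_of_chain`). By the ball-box inequality such a sample exists as soon as the privileged
box of parameter `r/(4 aMax)` is hit. That box has volume at least `(r/(4 aMax))^D` (`volume_box`),
so with `r = rₙ` it is missed with probability at most `n^(-(1+η)/D)`. A union bound over `O((n /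
log n)^(1/D))` boxes gives exactly the claimed rate.

Success alone only bounds the cost up to a factor. For near-optimality one also uses small boxes of
radius `β r`: a point whose small box is hit adds only `O(β r)` to the cost, so it suffices that
fewer than `2q`, `q ≈ g/(4r)`, small boxes are empty. After passing to a chain with the fewest steps
(`exists_minimal_chain`), small boxes of non-adjacent points are disjoint. Among `2q` empty ones,
`q` have indices of equal parity, and the union of these has mass at least `q s`, where `s` bounds
the mass of a single one from below. Summing `exp(-n q s)` over at most `2^(K+1)` index sets is
superpolynomially small, because `q` and `K` are both of order `1/r` while `n s` is of order `log n`
(`pi_real_failure_le`, `eventually_failure_bound`). -/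

namespace DPRM

variable {d m : ℕ}

/-! ### Calculus of trajectories: reversal, restriction, concatenation. -/

namespace Trajectory

variable {S : DCASystem d m}

theorem integrableOn_velocity (τ : Trajectory S) :
    IntegrableOn τ.velocity (Set.Icc 0 τ.T) := by
  have h : ∀ i, IntegrableOn (fun s => τ.u s i • S.g i (τ.x s)) (Set.Icc 0 τ.T) := by
    intro i
    have hc : ContinuousOn (fun s => S.g i (τ.x s)) (Set.Icc 0 τ.T) :=
      (S.smooth_g i).continuousOn.comp τ.continuousOn_x τ.x_mem
    obtain ⟨C, hC⟩ := S.isBounded_U.exists_norm_le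
    refine Integrable.bdd_smul (μ := volume.restrict (Set.Icc 0 τ.T)) (φ := fun s => τ.u s i)
      hc.integrableOn_Icc C ?_ ?_
    · exact ((measurable_pi_apply i).comp τ.measurable_u).aestronglyMeasurable
    · refine (ae_restrict_iff' measurableSet_Icc).2 (Eventually.of_forall fun s hs => ?_)
      exact (norm_le_pi_norm (τ.u s) i).trans (hC _ (τ.u_mem s hs))
  have h2 : IntegrableOn (fun s => ∑ i, τ.u s i • S.g i (τ.x s)) (Set.Icc 0 τ.T) :=
    integrable_finsetSum _ fun i _ => h i
  exact h2

theorem intervalIntegrable_velocity (τ : Trajectory S) {a b : ℝ} (ha : 0 ≤ a) (hab : a ≤ b)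
    (hb : b ≤ τ.T) : IntervalIntegrable τ.velocity volume a b :=
  (intervalIntegrable_iff_integrableOn_Icc_of_le hab).2
    (τ.integrableOn_velocity.mono_set (Set.Icc_subset_Icc ha hb))

theorem sub_eq_integral (τ : Trajectory S) {a b : ℝ} (ha : 0 ≤ a) (hab : a ≤ b) (hb : b ≤ τ.T) :
    τ.x b - τ.x a = ∫ s in a..b, τ.velocity s := by
  have h1 := τ.ode a ⟨ha, hab.trans hb⟩
  have h2 := τ.ode b ⟨ha.trans hab, hb⟩
  have h3 := intervalIntegral.integral_add_adjacent_intervals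
    (τ.intervalIntegrable_velocity le_rfl ha (hab.trans hb))
    (τ.intervalIntegrable_velocity ha hab hb)
  change _ = _ + ∫ s in (0 : ℝ)..a, τ.velocity s at h1
  change _ = _ + ∫ s in (0 : ℝ)..b, τ.velocity s at h2
  rw [h1, h2, ← h3]
  abel

theorem length_nonneg (τ : Trajectory S) : 0 ≤ τ.length :=
  intervalIntegral.integral_nonneg τ.T_nonneg fun _ _ => norm_nonneg _

theorem dist_le_integral (τ : Trajectory S) {a b : ℝ} (ha : 0 ≤ a) (hab : a ≤ b) (hb : b ≤ τ.T) :
    dist (τ.x a) (τ.x b) ≤ ∫ s in a..b, ‖τ.velocity s‖ := by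
  rw [dist_comm, dist_eq_norm, τ.sub_eq_integral ha hab hb]
  exact intervalIntegral.norm_integral_le_integral_norm hab

theorem integral_le_length (τ : Trajectory S) {a b : ℝ} (ha : 0 ≤ a) (hab : a ≤ b) (hb : b ≤ τ.T) :
    ∫ s in a..b, ‖τ.velocity s‖ ≤ τ.length :=
  intervalIntegral.integral_mono_interval ha hab hb
    (Eventually.of_forall fun _ => norm_nonneg _)
    (τ.intervalIntegrable_velocity le_rfl τ.T_nonneg le_rfl).norm

theorem dist_start_le (τ : Trajectory S) {t : ℝ} (ht : t ∈ Set.Icc 0 τ.T) :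
    dist (τ.x 0) (τ.x t) ≤ τ.length :=
  (τ.dist_le_integral le_rfl ht.1 ht.2).trans (τ.integral_le_length le_rfl ht.1 ht.2)

/-- The time reversal of a trajectory. -/
def reverse (τ : Trajectory S) : Trajectory S where
  T := τ.T
  T_nonneg := τ.T_nonneg
  x t := τ.x (τ.T - t)
  u t := -τ.u (τ.T - t)
  continuousOn_x := τ.continuousOn_x.comp (by fun_prop) fun t ht =>
    ⟨sub_nonneg.2 ht.2, sub_le_self _ ht.1⟩
  x_mem t ht := τ.x_mem _ ⟨sub_nonneg.2 ht.2, sub_le_self _ ht.1⟩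
  measurable_u := (τ.measurable_u.comp (measurable_const.sub measurable_id)).neg
  u_mem t ht := S.symm_U _ (τ.u_mem _ ⟨sub_nonneg.2 ht.2, sub_le_self _ ht.1⟩)
  ode t ht := by
    have h := τ.sub_eq_integral (sub_nonneg.2 ht.2) (sub_le_self _ ht.1) le_rfl
    have h2 : ∀ s, ∑ i, (-τ.u (τ.T - s)) i • S.g i (τ.x (τ.T - s)) = -τ.velocity (τ.T - s) := by
      intro s
      simp [velocity]
    simp only [h2, intervalIntegral.integral_neg, sub_zero]
    rw [intervalIntegral.integral_comp_sub_left, sub_zero, ← h]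
    abel

theorem velocity_reverse (τ : Trajectory S) (t : ℝ) :
    τ.reverse.velocity t = -τ.velocity (τ.T - t) := by
  simp [velocity, reverse]

theorem length_reverse (τ : Trajectory S) : τ.reverse.length = τ.length := by
  simp only [length, velocity_reverse, norm_neg]
  change ∫ t in (0 : ℝ)..τ.T, ‖τ.velocity (τ.T - t)‖ = _
  rw [intervalIntegral.integral_comp_sub_left (fun t => ‖τ.velocity t‖)]
  simp

/-- The part of a trajectory between the times `a` and `b`. -/
def restrict (τ : Trajectory S) (a b : ℝ) (ha : 0 ≤ a) (hab : a ≤ b) (hb : b ≤ τ.T) :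
    Trajectory S where
  T := b - a
  T_nonneg := sub_nonneg.2 hab
  x t := τ.x (a + t)
  u t := τ.u (a + t)
  continuousOn_x := τ.continuousOn_x.comp (by fun_prop) fun t ht =>
    ⟨add_nonneg ha ht.1, by linarith [ht.2]⟩
  x_mem t ht := τ.x_mem _ ⟨add_nonneg ha ht.1, by linarith [ht.2]⟩
  measurable_u := τ.measurable_u.comp (measurable_const.add measurable_id)
  u_mem t ht := τ.u_mem _ ⟨add_nonneg ha ht.1, by linarith [ht.2]⟩
  ode t ht := by
    have h := τ.sub_eq_integral ha (le_add_of_nonneg_right ht.1) (by linarith [ht.2])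
    change _ = _ + ∫ s in (0 : ℝ)..t, τ.velocity (a + s)
    rw [intervalIntegral.integral_comp_add_left, add_zero, ← h]
    abel

theorem length_restrict (τ : Trajectory S) (a b : ℝ) (ha : 0 ≤ a) (hab : a ≤ b) (hb : b ≤ τ.T) :
    (τ.restrict a b ha hab hb).length = ∫ s in a..b, ‖τ.velocity s‖ := by
  change ∫ t in (0 : ℝ)..(b - a), ‖τ.velocity (a + t)‖ = _
  rw [intervalIntegral.integral_comp_add_left (fun t => ‖τ.velocity t‖)]
  simp

section Concat

variable (τ₁ τ₂ : Trajectory S)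

/-- The state along the concatenation of two trajectories. -/
noncomputable def concatState (t : ℝ) : Euc d := if t ≤ τ₁.T then τ₁.x t else τ₂.x (t - τ₁.T)

/-- The control along the concatenation of two trajectories. -/
noncomputable def concatControl (t : ℝ) : Fin m → ℝ := if t ≤ τ₁.T then τ₁.u t else τ₂.u (t - τ₁.T)

/-- The velocity along the concatenation of two trajectories. -/
noncomputable def concatVelocity (t : ℝ) : Euc d := ∑ i, concatControl τ₁ τ₂ t i • S.g i (concatState τ₁ τ₂ t)

variable {τ₁ τ₂}

theorem concatVelocity_of_le {t : ℝ} (h : t ≤ τ₁.T) :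
    concatVelocity τ₁ τ₂ t = τ₁.velocity t := by
  simp [concatVelocity, concatControl, concatState, h, velocity]

theorem concatVelocity_of_lt {t : ℝ} (h : τ₁.T < t) :
    concatVelocity τ₁ τ₂ t = τ₂.velocity (t - τ₁.T) := by
  simp [concatVelocity, concatControl, concatState, h.not_ge, velocity]

theorem concatState_of_ge (h : τ₁.x τ₁.T = τ₂.x 0) {t : ℝ} (ht : τ₁.T ≤ t) :
    concatState τ₁ τ₂ t = τ₂.x (t - τ₁.T) := by
  rcases ht.eq_or_lt with rfl | ht
  · simp [concatState, h]
  · simp [concatState, ht.not_ge]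

/-- At the junction time the control is that of `τ₁`. Comparing integrands on the open interval
makes this single instant irrelevant. The general `f` serves both the state (`f = id`) and the
length (`f = ‖·‖`). -/
theorem integral_concatVelocity {F : Type*} [NormedAddCommGroup F] [NormedSpace ℝ F]
    (f : Euc d → F) {t : ℝ} (ht : τ₁.T ≤ t) :
    ∫ s in τ₁.T..t, f (concatVelocity τ₁ τ₂ s) =
      ∫ s in (0 : ℝ)..(t - τ₁.T), f (τ₂.velocity s) := by
  have : ∫ s in τ₁.T..t, f (concatVelocity τ₁ τ₂ s) =
      ∫ s in τ₁.T..t, f (τ₂.velocity (s - τ₁.T)) := by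
    refine intervalIntegral.integral_congr_Ioo_of_le ht fun s hs => ?_
    simp only [concatVelocity_of_lt hs.1]
  rw [this, intervalIntegral.integral_comp_sub_right (fun s => f (τ₂.velocity s)), sub_self]

theorem integral_concatVelocity_left {F : Type*} [NormedAddCommGroup F] [NormedSpace ℝ F]
    (f : Euc d → F) {t : ℝ} (h0 : 0 ≤ t) (ht : t ≤ τ₁.T) :
    ∫ s in (0 : ℝ)..t, f (concatVelocity τ₁ τ₂ s) = ∫ s in (0 : ℝ)..t, f (τ₁.velocity s) := by
  refine intervalIntegral.integral_congr_Ioo_of_le h0 fun s hs => ?_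
  simp only [concatVelocity_of_le (hs.2.le.trans ht)]

theorem intervalIntegrable_concatVelocity {t : ℝ} (ht : τ₁.T ≤ t) (ht2 : t ≤ τ₁.T + τ₂.T) :
    IntervalIntegrable (concatVelocity τ₁ τ₂) volume τ₁.T t := by
  have h := (τ₂.intervalIntegrable_velocity le_rfl (sub_nonneg.2 ht) (by linarith)).comp_sub_right
    τ₁.T
  rw [zero_add, sub_add_cancel] at h
  refine h.congr_ae ?_
  refine (ae_restrict_iff' measurableSet_uIoc).2 (Eventually.of_forall fun s hs => ?_)
  rw [Set.uIoc_of_le ht] at hs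
  exact (concatVelocity_of_lt hs.1).symm

theorem intervalIntegrable_concatVelocity_left :
    IntervalIntegrable (concatVelocity τ₁ τ₂) volume 0 τ₁.T := by
  refine (τ₁.intervalIntegrable_velocity le_rfl τ₁.T_nonneg le_rfl).congr_ae ?_
  refine (ae_restrict_iff' measurableSet_uIoc).2 (Eventually.of_forall fun s hs => ?_)
  rw [Set.uIoc_of_le τ₁.T_nonneg] at hs
  exact (concatVelocity_of_le hs.2).symm

/-- The concatenation of two trajectories. -/
noncomputable def concat (τ₁ τ₂ : Trajectory S) (h : τ₁.x τ₁.T = τ₂.x 0) : Trajectory S where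
  T := τ₁.T + τ₂.T
  T_nonneg := add_nonneg τ₁.T_nonneg τ₂.T_nonneg
  x := concatState τ₁ τ₂
  u := concatControl τ₁ τ₂
  continuousOn_x := by
    have h1 : ContinuousOn (concatState τ₁ τ₂) (Set.Icc 0 τ₁.T) :=
      τ₁.continuousOn_x.congr fun t ht => by simp [concatState, ht.2]
    have h2 : ContinuousOn (concatState τ₁ τ₂) (Set.Icc τ₁.T (τ₁.T + τ₂.T)) := by
      refine ContinuousOn.congr (f := fun t => τ₂.x (t - τ₁.T))
        (τ₂.continuousOn_x.comp (by fun_prop) fun t ht => ?_) fun t ht => ?_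
      · exact ⟨sub_nonneg.2 ht.1, by linarith [ht.2]⟩
      · exact concatState_of_ge h ht.1
    rw [← Set.Icc_union_Icc_eq_Icc τ₁.T_nonneg (le_add_of_nonneg_right τ₂.T_nonneg)]
    exact h1.union_of_isClosed h2 isClosed_Icc isClosed_Icc
  x_mem t ht := by
    rcases le_total t τ₁.T with h' | h'
    · simpa [concatState, h'] using τ₁.x_mem t ⟨ht.1, h'⟩
    · rw [concatState_of_ge h h']
      exact τ₂.x_mem _ ⟨sub_nonneg.2 h', by linarith [ht.2]⟩
  measurable_u := Measurable.ite measurableSet_Iic τ₁.measurable_u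
    (τ₂.measurable_u.comp (measurable_id.sub_const _))
  u_mem t ht := by
    rcases le_or_gt t τ₁.T with h' | h'
    · simpa [concatControl, h'] using τ₁.u_mem t ⟨ht.1, h'⟩
    · simpa [concatControl, h'.not_ge] using τ₂.u_mem (t - τ₁.T)
        ⟨sub_nonneg.2 h'.le, by linarith [ht.2]⟩
  ode t ht := by
    have h0 : concatState τ₁ τ₂ 0 = τ₁.x 0 := by simp [concatState, τ₁.T_nonneg]
    change _ = _ + ∫ s in (0 : ℝ)..t, concatVelocity τ₁ τ₂ s
    rw [h0]
    rcases le_total t τ₁.T with h' | h'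
    · have h1 := integral_concatVelocity_left (τ₁ := τ₁) (τ₂ := τ₂) id ht.1 h'
      simp only [id] at h1
      rw [h1, concatState, if_pos h']
      exact τ₁.ode t ⟨ht.1, h'⟩
    · have h1 := integral_concatVelocity_left (τ₁ := τ₁) (τ₂ := τ₂) id τ₁.T_nonneg le_rfl
      have h2 := integral_concatVelocity (τ₁ := τ₁) (τ₂ := τ₂) id h'
      simp only [id] at h1 h2
      rw [← intervalIntegral.integral_add_adjacent_intervals
        intervalIntegrable_concatVelocity_left (intervalIntegrable_concatVelocity h' ht.2), h1, h2,
        concatState_of_ge h h', ← τ₁.sub_eq_integral le_rfl τ₁.T_nonneg le_rfl,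
        ← τ₂.sub_eq_integral le_rfl (sub_nonneg.2 h') (by linarith [ht.2]), h]
      abel

theorem length_concat (h : τ₁.x τ₁.T = τ₂.x 0) :
    (concat τ₁ τ₂ h).length = τ₁.length + τ₂.length := by
  have hT : τ₁.T ≤ τ₁.T + τ₂.T := le_add_of_nonneg_right τ₂.T_nonneg
  change ∫ t in (0 : ℝ)..(τ₁.T + τ₂.T), ‖concatVelocity τ₁ τ₂ t‖ = _
  rw [← intervalIntegral.integral_add_adjacent_intervals
    intervalIntegrable_concatVelocity_left.norm (intervalIntegrable_concatVelocity hT le_rfl).norm,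
    integral_concatVelocity_left (fun v => ‖v‖) τ₁.T_nonneg le_rfl,
    integral_concatVelocity (fun v => ‖v‖) hT, add_sub_cancel_left]
  rfl

theorem joins_concat {p q r : Euc d} (h₁ : τ₁.Joins p q) (h₂ : τ₂.Joins q r) :
    (concat τ₁ τ₂ (h₁.2.trans h₂.1.symm)).Joins p r := by
  refine ⟨?_, ?_⟩
  · change concatState τ₁ τ₂ 0 = p
    simpa [concatState, τ₁.T_nonneg] using h₁.1
  · change concatState τ₁ τ₂ (τ₁.T + τ₂.T) = r
    rw [concatState_of_ge (h₁.2.trans h₂.1.symm) (le_add_of_nonneg_right τ₂.T_nonneg),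
      add_sub_cancel_left, h₂.2]

end Concat

end Trajectory

/-! ### The sub-Riemannian distance and chains along a trajectory. -/

namespace DCASystem

variable (S : DCASystem d m)

theorem sdist_le_of_joins {S : DCASystem d m} {τ : Trajectory S} {p q : Euc d} (h : τ.Joins p q) :
    S.sdist p q ≤ ENNReal.ofReal τ.length :=
  iInf₂_le τ h

theorem exists_of_sdist_lt {S : DCASystem d m} {p q : Euc d} {c : ENNReal} (h : S.sdist p q < c) :
    ∃ τ : Trajectory S, τ.Joins p q ∧ ENNReal.ofReal τ.length < c := by
  simpa [sdist, iInf_lt_iff] using h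

/-- Arc length dominates displacement. Unlike the lower bound in `distComparison`, this holds at
every scale, so sub-Riemannian balls always lie in Euclidean ones. -/
theorem ofReal_dist_le_sdist (p q : Euc d) : ENNReal.ofReal (dist p q) ≤ S.sdist p q := by
  refine le_iInf₂ fun τ h => ENNReal.ofReal_le_ofReal ?_
  rw [← h.1, ← h.2]
  exact τ.dist_start_le ⟨τ.T_nonneg, le_rfl⟩

theorem dist_lt_of_sdist_lt {S : DCASystem d m} {p q : Euc d} {c : ℝ}
    (h : S.sdist p q < ENNReal.ofReal c) : dist p q < c :=
  (ENNReal.ofReal_lt_ofReal_iff_of_nonneg dist_nonneg).1 ((S.ofReal_dist_le_sdist p q).trans_lt h)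

theorem sdist_comm (p q : Euc d) : S.sdist p q = S.sdist q p := by
  have key : ∀ p q, S.sdist p q ≤ S.sdist q p := fun p q => by
    refine le_iInf₂ fun τ h => ?_
    have hj : τ.reverse.Joins p q := by
      refine ⟨?_, ?_⟩
      · change τ.x (τ.T - 0) = p
        rw [sub_zero, h.2]
      · change τ.x (τ.T - τ.T) = q
        rw [sub_self, h.1]
    exact (sdist_le_of_joins hj).trans_eq (by rw [τ.length_reverse])
  exact le_antisymm (key p q) (key q p)

theorem sdist_triangle (p q r : Euc d) : S.sdist p r ≤ S.sdist p q + S.sdist q r := by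
  refine ENNReal.le_of_forall_pos_le_add fun ε hε hfin => ?_
  have hε' : ((ε : ENNReal) / 2) ≠ 0 := by simpa using hε.ne'
  obtain ⟨τ₁, h₁, hl₁⟩ := exists_of_sdist_lt
    (ENNReal.lt_add_right (ENNReal.add_lt_top.1 hfin).1.ne hε')
  obtain ⟨τ₂, h₂, hl₂⟩ := exists_of_sdist_lt
    (ENNReal.lt_add_right (ENNReal.add_lt_top.1 hfin).2.ne hε')
  calc S.sdist p r ≤ ENNReal.ofReal (τ₁.concat τ₂ (h₁.2.trans h₂.1.symm)).length :=
        sdist_le_of_joins (Trajectory.joins_concat h₁ h₂)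
    _ = ENNReal.ofReal τ₁.length + ENNReal.ofReal τ₂.length := by
        rw [Trajectory.length_concat, ENNReal.ofReal_add τ₁.length_nonneg τ₂.length_nonneg]
    _ ≤ (S.sdist p q + ε / 2) + (S.sdist q r + ε / 2) := add_le_add hl₁.le hl₂.le
    _ = S.sdist p q + S.sdist q r + ε := by
        rw [add_add_add_comm, ENNReal.add_halves]

end DCASystem

theorem Trajectory.sdist_le_integral {S : DCASystem d m} (τ : Trajectory S) {a b : ℝ} (ha : 0 ≤ a)
    (hab : a ≤ b) (hb : b ≤ τ.T) :
    S.sdist (τ.x a) (τ.x b) ≤ ENNReal.ofReal (∫ s in a..b, ‖τ.velocity s‖) := by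
  rw [← τ.length_restrict a b ha hab hb]
  refine DCASystem.sdist_le_of_joins ⟨?_, ?_⟩
  · simp [Trajectory.restrict]
  · simp [Trajectory.restrict]

/-- Along a trajectory, the endpoints are joined by a chain of points with prescribed maximal
spacing. -/
theorem Trajectory.exists_chain {S : DCASystem d m} (τ : Trajectory S) {h : ℝ} (hh : 0 < h) :
    ∃ p : ℕ → Euc d, p 0 = τ.x 0 ∧ p ⌈τ.length / h⌉₊ = τ.x τ.T ∧
      (∀ k, p k ∈ τ.x '' Set.Icc 0 τ.T) ∧
      ∀ k, S.sdist (p k) (p (k + 1)) ≤ ENNReal.ofReal h := by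
  set A : ℝ → ℝ := fun t => ∫ s in (0 : ℝ)..t, ‖τ.velocity s‖ with hA
  have hint : IntegrableOn (fun s => ‖τ.velocity s‖) (Set.uIcc 0 τ.T) := by
    rw [Set.uIcc_of_le τ.T_nonneg]
    exact τ.integrableOn_velocity.norm
  have hcont : ContinuousOn A (Set.Icc 0 τ.T) := by
    have := intervalIntegral.continuousOn_primitive_interval hint
    rwa [Set.uIcc_of_le τ.T_nonneg] at this
  have hadd : ∀ {a b : ℝ}, 0 ≤ a → a ≤ b → b ≤ τ.T →
      A b - A a = ∫ s in a..b, ‖τ.velocity s‖ := by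
    intro a b ha hab hb
    have := intervalIntegral.integral_add_adjacent_intervals
      (τ.intervalIntegrable_velocity le_rfl ha (hab.trans hb)).norm
      (τ.intervalIntegrable_velocity ha hab hb).norm
    simp only [hA]
    linarith
  have hA0 : A 0 = 0 := by simp [hA]
  have hAT : A τ.T = τ.length := rfl
  -- Sample at equal steps of arc length `A`. Truncating at the total length keeps the chain
  -- defined, and stationary, past the endpoint.
  have hex : ∀ k : ℕ, ∃ t ∈ Set.Icc 0 τ.T, A t = min (k * h) τ.length := by
    intro k
    have := intermediate_value_Icc τ.T_nonneg hcont
    rw [hA0, hAT] at this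
    exact this ⟨le_min (by positivity) τ.length_nonneg, min_le_right _ _⟩
  choose t ht htA using hex
  have hstep : ∀ {a b : ℝ}, a ∈ Set.Icc 0 τ.T → b ∈ Set.Icc 0 τ.T → |A a - A b| ≤ h →
      S.sdist (τ.x a) (τ.x b) ≤ ENNReal.ofReal h := by
    intro a b ha hb hab
    rcases le_total a b with h' | h'
    · refine (τ.sdist_le_integral ha.1 h' hb.2).trans (ENNReal.ofReal_le_ofReal ?_)
      rw [← hadd ha.1 h' hb.2]
      exact (le_abs_self _).trans ((abs_sub_comm _ _).trans_le hab)
    · rw [S.sdist_comm]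
      refine (τ.sdist_le_integral hb.1 h' ha.2).trans (ENNReal.ofReal_le_ofReal ?_)
      rw [← hadd hb.1 h' ha.2]
      exact (le_abs_self _).trans hab
  -- `A` need not be injective, since the trajectory may rest; equal arc length still forces equal
  -- position, which identifies both ends of the chain.
  have hzero : ∀ {a b : ℝ}, a ∈ Set.Icc 0 τ.T → b ∈ Set.Icc 0 τ.T → A a = A b →
      τ.x a = τ.x b := by
    intro a b ha hb hab
    rcases le_total a b with h' | h'
    · have := τ.dist_le_integral ha.1 h' hb.2
      rw [← hadd ha.1 h' hb.2, hab, sub_self] at this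
      exact dist_le_zero.1 this
    · have := τ.dist_le_integral hb.1 h' ha.2
      rw [← hadd hb.1 h' ha.2, hab, sub_self] at this
      exact (dist_le_zero.1 this).symm
  refine ⟨fun k => τ.x (t k), ?_, ?_, fun k => ⟨t k, ht k, rfl⟩, fun k => ?_⟩
  · refine hzero (ht 0) ⟨le_rfl, τ.T_nonneg⟩ ?_
    rw [htA, hA0]
    simp [τ.length_nonneg]
  · refine hzero (ht _) ⟨τ.T_nonneg, le_rfl⟩ ?_
    rw [htA, hAT, min_eq_right]
    exact (div_le_iff₀ hh).1 (Nat.le_ceil _)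
  · refine hstep (ht k) (ht (k + 1)) ?_
    rw [htA, htA, abs_sub_comm]
    refine (abs_min_sub_min_le_max _ _ _ _).trans (max_le ?_ ?_)
    · push_cast
      rw [add_mul, add_sub_cancel_left, one_mul, abs_of_pos hh]
    · simpa using hh.le

/-! ### Volume and topology of boxes in privileged coordinates. -/

/-- The shear `y ↦ y + f(y) eᵢ` of `ℝᵈ`, where `f` does not depend on the coordinate `yᵢ`. -/
def shear (i : Fin d) (f : (Fin d → ℝ) → ℝ) (hf : Continuous f)
    (hi : ∀ y t, f (Function.update y i t) = f y) : (Fin d → ℝ) ≃ₜ (Fin d → ℝ) where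
  toFun y := Function.update y i (y i + f y)
  invFun y := Function.update y i (y i - f y)
  left_inv y := by simp [hi]
  right_inv y := by simp [hi]
  continuous_toFun := continuous_id.update i ((continuous_apply i).add hf)
  continuous_invFun := continuous_id.update i ((continuous_apply i).sub hf)

/-- Integrate over the `i`-th coordinate alone: on each such line the shear is a translation by a
constant. -/
theorem measurePreserving_shear (i : Fin d) (f : (Fin d → ℝ) → ℝ) (hf : Continuous f)
    (hi : ∀ y t, f (Function.update y i t) = f y) :
    MeasurePreserving (shear i f hf hi) volume volume := by
  have hm : Measurable (shear i f hf hi) := (shear i f hf hi).continuous.measurable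
  refine ⟨hm, Measure.ext fun s hs => ?_⟩
  rw [Measure.map_apply hm hs, ← lintegral_indicator_one (hm hs), ← lintegral_indicator_one hs]
  refine lintegral_eq_of_lmarginal_eq {i} (measurable_const.indicator (hm hs))
    (measurable_const.indicator hs) ?_
  rw [lmarginal_singleton, lmarginal_singleton]
  funext y
  have : ∀ t, ((shear i f hf hi ⁻¹' s).indicator 1 (Function.update y i t) : ENNReal) =
      (fun t => s.indicator 1 (Function.update y i t)) (t + f y) := by
    intro t
    have h : shear i f hf hi (Function.update y i t) = Function.update y i (t + f y) := by
      change Function.update (Function.update y i t) i _ = _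
      simp [hi]
    change (s.indicator 1 (shear i f hf hi (Function.update y i t)) : ENNReal) = _
    rw [h]
  simp only [this]
  exact lintegral_add_right_eq_self (μ := (volume : Measure ℝ))
    (fun t => s.indicator 1 (Function.update y i t)) (f y)

/-- A triangular change of coordinates is a volume preserving homeomorphism. -/
theorem exists_homeomorph_triangular (P : Fin d → (Fin d → ℝ) → ℝ) (hP : ∀ i, Continuous (P i))
    (htri : ∀ i y y', (∀ j < i, y j = y' j) → P i y = P i y') :
    ∃ e : (Fin d → ℝ) ≃ₜ (Fin d → ℝ), (∀ y i, e y i = y i + P i y) ∧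
      MeasurePreserving e volume volume := by
  -- Correct the coordinates from the last one downwards. When coordinate `i₀` is treated, all lower
  -- ones are still untouched, so `P i₀` takes its value at the original point.
  have key : ∀ k ≤ d, ∃ e : (Fin d → ℝ) ≃ₜ (Fin d → ℝ),
      (∀ y i, e y i = y i + if d ≤ (i : ℕ) + k then P i y else 0) ∧
      MeasurePreserving e volume volume := by
    intro k
    induction k with
    | zero =>
      intro _
      refine ⟨Homeomorph.refl _, fun y i => ?_, MeasurePreserving.id _⟩
      simp [i.2]
    | succ k ih =>
      intro hk
      obtain ⟨e, he, hmp⟩ := ih (by omega)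
      let i₀ : Fin d := ⟨d - (k + 1), by omega⟩
      have hind : ∀ y t, P i₀ (Function.update y i₀ t) = P i₀ y := fun y t =>
        htri _ _ _ fun j hj => Function.update_of_ne hj.ne _ _
      refine ⟨e.trans (shear i₀ (P i₀) (hP i₀) hind), fun y i => ?_,
        (measurePreserving_shear i₀ _ (hP i₀) hind).comp hmp⟩
      have hPe : P i₀ (e y) = P i₀ y := htri _ _ _ fun j hj => by
        have : (j : ℕ) < d - (k + 1) := hj
        rw [he, if_neg (by omega), add_zero]
      change Function.update (e y) i₀ (e y i₀ + P i₀ (e y)) i = _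
      rcases eq_or_ne i i₀ with rfl | hne
      · rw [Function.update_self, hPe, he, if_neg (by simp only [i₀]; omega),
          if_pos (by simp only [i₀]; omega), add_zero]
      · have : (i : ℕ) ≠ d - (k + 1) := fun h => hne (Fin.ext h)
        rw [Function.update_of_ne hne, he]
        congr 1
        exact if_congr (by omega) rfl rfl
  obtain ⟨e, he, hmp⟩ := key d le_rfl
  exact ⟨e, fun y i => by simp [he], hmp⟩

namespace PrivilegedCoords

variable {S : DCASystem d m} {x₀ : Euc d}

/-- Privileged coordinates are a volume preserving homeomorphism. -/
theorem exists_homeomorph (c : PrivilegedCoords S x₀) :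
    ∃ e : Euc d ≃ₜ (Fin d → ℝ), (∀ x, e x = c.z x) ∧ MeasurePreserving e volume volume := by
  obtain ⟨e, he, hmp⟩ := exists_homeomorph_triangular
    (fun i y => MvPolynomial.eval y (c.poly i)) (fun i => MvPolynomial.continuous_eval _)
    (fun i y y' h => by
      refine MvPolynomial.eval₂_congr _ _ _ fun {j α} hj hα => h j ?_
      by_contra hij
      exact Finsupp.mem_support_iff.1 hj
        (c.triangular i α (MvPolynomial.mem_support_iff.2 hα) j (not_lt.1 hij)))
  refine ⟨((Homeomorph.subRight x₀).trans c.frame.repr.toHomeomorph).trans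
    ((PiLp.homeomorph 2 fun _ : Fin d => ℝ).trans e), fun x => ?_, ?_⟩
  · funext i
    have hy : ∀ j, (c.frame.repr (x - x₀)).ofLp j = c.y x j := fun j =>
      c.frame.repr_apply_apply _ _
    change e (c.frame.repr (x - x₀)).ofLp i = _
    rw [he, funext hy]
    rfl
  · exact (hmp.comp (PiLp.volume_preserving_ofLp (Fin d))).comp
      (c.frame.measurePreserving_repr.comp (measurePreserving_sub_right volume x₀))

theorem z_self (c : PrivilegedCoords S x₀) (i : Fin d) : c.z x₀ i = 0 := by
  have hy : c.y x₀ = 0 := by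
    funext j
    simp [y]
  have h0 : (c.poly i).coeff 0 = 0 := by
    by_contra h
    simpa using (c.poly_degree i 0 (MvPolynomial.mem_support_iff.2 h)).1
  rw [z, hy]
  simpa [← MvPolynomial.constantCoeff_eq, MvPolynomial.eval_zero] using h0

/-- The anisotropic box of radius `ρ` in privileged coordinates. -/
def box (c : PrivilegedCoords S x₀) (ρ : ℝ) : Set (Euc d) :=
  {x | ∀ i, |c.z x i| < ρ ^ S.weight x₀ i}

theorem self_mem_box (c : PrivilegedCoords S x₀) {ρ : ℝ} (hρ : 0 < ρ) : x₀ ∈ c.box ρ := fun i => by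
  rw [c.z_self, abs_zero]
  positivity

theorem box_eq_preimage (c : PrivilegedCoords S x₀) {e : Euc d ≃ₜ (Fin d → ℝ)}
    (he : ∀ x, e x = c.z x) (ρ : ℝ) :
    c.box ρ = e ⁻¹' Set.univ.pi fun i => Metric.ball 0 (ρ ^ S.weight x₀ i) := by
  ext x
  simp [box, he]

theorem isOpen_box (c : PrivilegedCoords S x₀) (ρ : ℝ) : IsOpen (c.box ρ) := by
  obtain ⟨e, he, -⟩ := c.exists_homeomorph
  rw [c.box_eq_preimage he]
  exact (isOpen_set_pi Set.finite_univ fun _ _ => Metric.isOpen_ball).preimage e.continuous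

theorem isPreconnected_box (c : PrivilegedCoords S x₀) (ρ : ℝ) : IsPreconnected (c.box ρ) := by
  obtain ⟨e, he, -⟩ := c.exists_homeomorph
  rw [c.box_eq_preimage he, e.isPreconnected_preimage]
  exact (convex_pi fun i _ => convex_ball 0 _).isPreconnected

/-- The side lengths `2 ρ^wᵢ` multiply to a power with exponent `∑ wᵢ`; this is how the homogeneous
dimension enters. -/
theorem volume_box (c : PrivilegedCoords S x₀) {ρ : ℝ} (hρ : 0 < ρ) :
    volume (c.box ρ) = ENNReal.ofReal (2 ^ d * ρ ^ S.homDim x₀) := by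
  obtain ⟨e, he, hmp⟩ := c.exists_homeomorph
  rw [c.box_eq_preimage he, hmp.measure_preimage_emb e.measurableEmbedding, volume_pi_pi]
  simp only [Real.volume_ball]
  rw [← ENNReal.ofReal_prod_of_nonneg fun i _ => by positivity, Finset.prod_mul_distrib,
    Finset.prod_pow_eq_pow_sum]
  simp [DCASystem.homDim]

theorem pseudonorm_lt_of_mem_box (c : PrivilegedCoords S x₀) (hw : ∀ i, S.weight x₀ i ≠ 0) {ρ : ℝ}
    (hρ : 0 < ρ) {x : Euc d} (hx : x ∈ c.box ρ) : c.pseudonorm x < ρ := by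
  have h : ∀ i, |c.z x i| ^ (1 / (S.weight x₀ i : ℝ)) < ρ := fun i => by
    have h1 := Real.rpow_lt_rpow (abs_nonneg _) (hx i)
      (show 0 < 1 / (S.weight x₀ i : ℝ) by have := Nat.pos_of_ne_zero (hw i); positivity)
    rwa [one_div, Real.pow_rpow_inv_natCast hρ.le (hw i), ← one_div] at h1
  -- For `d = 0` the supremum is `0` by convention; otherwise it is attained, which preserves
  -- strictness.
  rcases isEmpty_or_nonempty (Fin d) with _ | _
  · rw [pseudonorm, Real.iSup_of_isEmpty]
    exact hρ
  · obtain ⟨i, hi⟩ := exists_eq_ciSup_of_finite (f := fun i => |c.z x i| ^ (1 / (S.weight x₀ i : ℝ)))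
    rw [pseudonorm, ← hi]
    exact h i

end PrivilegedCoords

/-! ### Weights, continuity of the distance, and the ball-box inclusion. -/

namespace DCASystem

variable (S : DCASystem d m)

theorem monotone_flagAt (x : Euc d) : Monotone fun k => S.flagAt k x := by
  refine monotone_nat_of_le_succ fun k => Submodule.map_mono ?_
  cases k with
  | zero => exact bot_le
  | succ k => exact le_sup_left

theorem growth_zero (x : Euc d) : S.growth 0 x = 0 := by
  rw [growth, flagAt, lieFlag, Submodule.map_bot, finrank_bot]

end DCASystem

namespace SystemAssumptions

variable {S : DCASystem d m} {Z : CoordSystem S} {aMin aMax σMin θMin : ℝ}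

theorem exists_flagAt_eq_top (hS : SystemAssumptions S Z aMin aMax σMin θMin) {x : Euc d}
    (hx : x ∈ S.M) : ∃ k, S.flagAt k x = ⊤ :=
  ⟨_, (WellFoundedGT.iSup_eq_monotonicSequenceLimit
    ⟨fun k => S.flagAt k x, S.monotone_flagAt x⟩).symm.trans (hS.bracketGenerating x hx)⟩

theorem weight_ne_zero (hS : SystemAssumptions S Z aMin aMax σMin θMin) {x : Euc d}
    (hx : x ∈ S.M) (i : Fin d) : S.weight x i ≠ 0 := by
  obtain ⟨k, hk⟩ := hS.exists_flagAt_eq_top hx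
  -- Without nonemptiness the weight would be the default value `sInf ∅ = 0`.
  have hne : {k | (i : ℕ) < S.growth k x}.Nonempty := ⟨k, by
    rw [Set.mem_ofPred_eq, DCASystem.growth, hk, finrank_top, finrank_euclideanSpace_fin]
    exact i.2⟩
  intro h
  have := Nat.sInf_mem hne
  rw [Set.mem_ofPred_eq] at this
  change _ < S.growth (S.weight x i) x at this
  rw [h, S.growth_zero] at this
  exact Nat.not_lt_zero _ this

theorem homDim_pos (hS : SystemAssumptions S Z aMin aMax σMin θMin) (hd : d ≠ 0) {x : Euc d}
    (hx : x ∈ S.M) : 0 < S.homDim x := by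
  have : NeZero d := ⟨hd⟩
  exact Finset.sum_pos (fun i _ => Nat.pos_of_ne_zero (hS.weight_ne_zero hx i))
    Finset.univ_nonempty

theorem degree_ne_zero (hS : SystemAssumptions S Z aMin aMax σMin θMin) (hd : d ≠ 0) {x : Euc d}
    (hx : x ∈ S.M) : S.degree x ≠ 0 := by
  intro h
  have h1 : S.flagAt (S.degree x) x = ⊤ := Nat.sInf_mem (hS.exists_flagAt_eq_top hx)
  have h2 : S.growth (S.degree x) x = d := by
    rw [DCASystem.growth, h1, finrank_top, finrank_euclideanSpace_fin]
  rw [h, S.growth_zero] at h2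
  exact hd h2.symm

theorem aMax_pos (hS : SystemAssumptions S Z aMin aMax σMin θMin) : 0 < aMax :=
  hS.aMin_pos.trans_le hS.aMin_le

/-- By regularity `homDim` is locally constant on `M`, and the time interval is connected. Hence a
radius calibrated at the initial state suits every box along the trajectory. -/
theorem homDim_eq (hS : SystemAssumptions S Z aMin aMax σMin θMin) (τ : Trajectory S) {s t : ℝ}
    (hs : s ∈ Set.Icc 0 τ.T) (ht : t ∈ Set.Icc 0 τ.T) :
    S.homDim (τ.x s) = S.homDim (τ.x t) := by
  have h : ContinuousOn S.homDim S.M := fun x hx => by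
    refine ContinuousAt.continuousWithinAt ?_
    have : S.homDim =ᶠ[𝓝 x] fun _ => S.homDim x := by
      filter_upwards [hS.regular x hx] with y hy
      simp only [DCASystem.homDim, DCASystem.weight, hy]
    exact continuousAt_const.congr this.symm
  exact isPreconnected_Icc.constant (h.comp τ.continuousOn_x τ.x_mem) hs ht

/-- The exponent `1 / degree` must be positive. In dimension `0` the degree is `0`, and the bound
would be the constant `2 * aMax`. -/
theorem tendsto_sdist (hS : SystemAssumptions S Z aMin aMax σMin θMin) (hd : d ≠ 0) {x : Euc d}
    (hx : x ∈ S.M) : Tendsto (fun y => S.sdist x y) (𝓝 x) (𝓝 0) := by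
  have hk : 0 < 1 / (S.degree x : ℝ) := by
    have := Nat.pos_of_ne_zero (hS.degree_ne_zero hd hx)
    positivity
  have h1 : Tendsto (fun y => ENNReal.ofReal (2 * aMax * ‖x - y‖ ^ (1 / (S.degree x : ℝ))))
      (𝓝 x) (𝓝 0) := by
    have h2 : Continuous fun y => 2 * aMax * ‖x - y‖ ^ (1 / (S.degree x : ℝ)) :=
      continuous_const.mul ((continuous_const.sub continuous_id).norm.rpow_const
        fun _ => Or.inr hk.le)
    have h3 := (ENNReal.continuous_ofReal.comp h2).tendsto x
    simp only [Function.comp_apply, sub_self, norm_zero, Real.zero_rpow hk.ne', mul_zero,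
      ENNReal.ofReal_zero] at h3
    exact h3
  refine tendsto_of_tendsto_of_tendsto_of_le_of_le' tendsto_const_nhds h1
    (Eventually.of_forall fun _ => zero_le) ?_
  filter_upwards [S.isOpen_M.mem_nhds hx, Metric.closedBall_mem_nhds x hS.θMin_pos] with y hy hy2
  refine (hS.distComparison x hx y hy ?_).2
  rwa [mem_closedBall_iff_norm'] at hy2

theorem sdist_self (hS : SystemAssumptions S Z aMin aMax σMin θMin) (hd : d ≠ 0) {x : Euc d}
    (hx : x ∈ S.M) : S.sdist x x = 0 := by
  have := (hS.tendsto_sdist hd hx).mono_left (pure_le_nhds x)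
  exact tendsto_nhds_unique (tendsto_pure_nhds _ _) this

/-- The ball-box inequality, formulated for boxes: a small box in privileged coordinates is
contained in a sub-Riemannian ball. -/
theorem box_subset (hS : SystemAssumptions S Z aMin aMax σMin θMin) (hd : d ≠ 0) (p : S.M) {ρ : ℝ}
    (hρ : 0 < ρ) (hσ : aMax * ρ < σMin) (hM : Metric.closedBall (p : Euc d) (aMax * ρ) ⊆ S.M) :
    (Z p).box ρ ⊆ {x | x ∈ S.M ∧ S.sdist p x < ENNReal.ofReal (aMax * ρ)} := by
  have hσ' : ENNReal.ofReal (aMax * ρ) < ENNReal.ofReal σMin :=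
    (ENNReal.ofReal_lt_ofReal_iff hS.σMin_pos).2 hσ
  -- The ball-box inequality is only available where the distance is already below `σMin`.
  -- Connectedness of the box removes this circularity: `u` is open, contains the centre, and is
  -- relatively closed in the box because on `u` the distance improves to below `aMax * ρ < σMin`.
  set u : Set (Euc d) := {x | x ∈ S.M ∧ S.sdist p x < ENNReal.ofReal σMin} with hu
  have hbox : ∀ x ∈ u, x ∈ (Z p).box ρ → S.sdist p x < ENNReal.ofReal (aMax * ρ) := by
    intro x hx hxb
    refine (hS.ballBox p x hx.1 hx.2).2.trans_lt ?_
    refine (ENNReal.ofReal_lt_ofReal_iff (mul_pos hS.aMax_pos hρ)).2 ?_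
    exact mul_lt_mul_of_pos_left
      ((Z p).pseudonorm_lt_of_mem_box (hS.weight_ne_zero p.2) hρ hxb) hS.aMax_pos
  have huo : IsOpen u := by
    refine isOpen_iff_mem_nhds.2 fun x hx => ?_
    have h1 : Tendsto (fun y => S.sdist p x + S.sdist x y) (𝓝 x) (𝓝 (S.sdist p x + 0)) :=
      tendsto_const_nhds.add (hS.tendsto_sdist hd hx.1)
    rw [add_zero] at h1
    filter_upwards [S.isOpen_M.mem_nhds hx.1, h1.eventually (gt_mem_nhds hx.2)] with y hy hy2
    exact ⟨hy, (S.sdist_triangle _ _ _).trans_lt hy2⟩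
  have hsub : (Z p).box ρ ⊆ u := by
    refine ((Z p).isPreconnected_box ρ).subset_of_closure_inter_subset huo
      ⟨p, (Z p).self_mem_box hρ, p.2, ?_⟩ ?_
    · rw [hS.sdist_self hd p.2]
      exact ENNReal.ofReal_pos.2 hS.σMin_pos
    · rintro x ⟨hxu, hxb⟩
      have hfr : ∃ᶠ y in 𝓝 x, y ∈ u := mem_closure_iff_frequently.1 hxu
      have hev : ∀ᶠ y in 𝓝 x, y ∈ (Z p).box ρ := ((Z p).isOpen_box ρ).mem_nhds hxb
      have hfr2 : ∃ᶠ y in 𝓝 x, S.sdist p y < ENNReal.ofReal (aMax * ρ) :=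
        (hfr.and_eventually hev).mono fun y hy => hbox y hy.1 hy.2
      -- A limit of points of `u` could leave `M`; the Euclidean ball contained in `M` prevents
      -- this.
      have hxM : x ∈ S.M := by
        refine hM ?_
        have : ∃ᶠ y in 𝓝 x, y ∈ Metric.closedBall (p : Euc d) (aMax * ρ) := hfr2.mono fun y hy => by
          rw [Metric.mem_closedBall, dist_comm]
          exact (DCASystem.dist_lt_of_sdist_lt hy).le
        exact Metric.isClosed_closedBall.mem_of_frequently_of_tendsto this tendsto_id
      refine ⟨hxM, lt_of_le_of_lt ?_ hσ'⟩
      refine ENNReal.le_of_forall_pos_le_add fun ε hε _ => ?_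
      obtain ⟨y, hy1, hy2⟩ := (hfr2.and_eventually ((hS.tendsto_sdist hd hxM).eventually
        (gt_mem_nhds (show (0 : ENNReal) < ε by exact_mod_cast hε)))).exists
      calc S.sdist p x ≤ S.sdist p y + S.sdist y x := S.sdist_triangle _ _ _
        _ ≤ _ := add_le_add hy1.le (by rw [S.sdist_comm]; exact hy2.le)
  exact fun x hx => ⟨(hsub hx).1, hbox x (hsub hx) hx⟩

end SystemAssumptions

/-! ### Deterministic part: minimal chains, clearance, and roadmap paths. -/

/-- If two points are joined by a chain of `N` steps, then a chain of the least possible number of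
steps has no two non-consecutive vertices that are related. -/
theorem exists_minimal_chain {α : Type*} (R : α → α → Prop) (C : Set α) {N : ℕ} {p : ℕ → α}
    (hC : ∀ k, p k ∈ C) (hR : ∀ k < N, R (p k) (p (k + 1))) :
    ∃ K ≤ N, ∃ q : ℕ → α, q 0 = p 0 ∧ q K = p N ∧ (∀ k, q k ∈ C) ∧
      (∀ k < K, R (q k) (q (k + 1))) ∧ ∀ i j, i + 1 < j → j ≤ K → ¬ R (q i) (q j) := by
  classical
  have hex : ∃ K, ∃ q : ℕ → α, q 0 = p 0 ∧ q K = p N ∧ (∀ k, q k ∈ C) ∧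
      ∀ k < K, R (q k) (q (k + 1)) := ⟨N, p, rfl, rfl, hC, hR⟩
  obtain ⟨q, h0, hK, hqC, hqR⟩ := Nat.find_spec hex
  refine ⟨Nat.find hex, Nat.find_min' hex ⟨p, rfl, rfl, hC, hR⟩, q, h0, hK, hqC, hqR,
    fun i j hij hj hRij => ?_⟩
  -- A relation between `q i` and `q j` would allow the `j - i - 1` vertices between them to be cut
  -- out, contradicting minimality.
  refine Nat.find_min hex (m := Nat.find hex - (j - i - 1)) (by omega)
    ⟨fun k => if k ≤ i then q k else q (k + (j - i - 1)), by simpa using h0, ?_, fun k => ?_,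
      fun k hk => ?_⟩
  · beta_reduce
    rw [if_neg (by omega), Nat.sub_add_cancel (by omega), hK]
  · beta_reduce
    split_ifs
    · exact hqC _
    · exact hqC _
  · beta_reduce
    rcases lt_trichotomy k i with h | rfl | h
    · rw [if_pos h.le, if_pos (by omega)]
      exact hqR k (by omega)
    · rw [if_pos le_rfl, if_neg (by omega), show k + 1 + (j - k - 1) = j by omega]
      exact hRij
    · rw [if_neg (by omega), if_neg (by omega), show k + 1 + (j - i - 1) = k + (j - i - 1) + 1 by
        omega]
      exact hqR _ (by omega)

/-- A point has room `κ` if around it, up to distance `κ`, there are no obstacles and the steering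
procedure is defined. -/
def HasRoom {S : DCASystem d m} (P : PlanningProblem S) (E : Steering S) (κ : ℝ) (p : Euc d) :
    Prop :=
  Metric.closedBall p κ ⊆ S.M \ P.obs ∧
    ∀ u ∈ Metric.closedBall p κ, ∀ v ∈ Metric.closedBall p κ, ∃ τ, E.edge u v = some τ

/-- A nearby member `ψ α` of the homotopy has strong clearance and almost the optimal length, but
may end on the boundary of the goal. Appending a piece shorter than both the remaining budget and
half the clearance brings it inside. -/
theorem exists_reference_trajectory {S : DCASystem d m} {Z : CoordSystem S}
    {aMin aMax σMin θMin : ℝ} (hS : SystemAssumptions S Z aMin aMax σMin θMin) (hd : d ≠ 0)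
    (P : PlanningProblem S) (E : Steering S) {τ : Trajectory S} (hτ : P.IsFeasible τ) {δ : ℝ}
    (hclear : P.WeakClearance δ τ) {c : ℝ} (hc : τ.length < c) :
    ∃ γ : Trajectory S, ∃ κ > 0, γ.x 0 = P.init ∧ γ.length < c ∧
      Metric.ball (γ.x γ.T) κ ⊆ P.goal ∧ ∀ q ∈ γ.x '' Set.Icc 0 γ.T, HasRoom P E κ q := by
  obtain ⟨-, ψ, -, -, -, hjoin, hlen, hstrong⟩ := hclear
  obtain ⟨α, hα1, hα⟩ := ((hlen.eventually (gt_mem_nhds hc)).and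
    (Ioc_mem_nhdsGT zero_lt_one)).exists
  obtain ⟨δ', hδ', -, hobs⟩ := hstrong α hα
  have hj := hjoin α (Set.Ioc_subset_Icc_self hα)
  set γ₁ := ψ α
  rw [hτ.2.1] at hj
  have hpM : τ.x τ.T ∈ S.M := τ.x_mem _ ⟨τ.T_nonneg, le_rfl⟩
  obtain ⟨y, hyg, hy⟩ := ((mem_closure_iff_frequently.1 hτ.2.2).and_eventually
    ((hS.tendsto_sdist hd hpM).eventually (gt_mem_nhds
      (show 0 < ENNReal.ofReal (min (c - γ₁.length) (δ' / 2)) from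
        ENNReal.ofReal_pos.2 (lt_min (sub_pos.2 hα1) (half_pos hδ')))))).exists
  obtain ⟨γ₂, hj₂, hl₂⟩ := DCASystem.exists_of_sdist_lt hy
  rw [ENNReal.ofReal_lt_ofReal_iff_of_nonneg γ₂.length_nonneg] at hl₂
  have hxx := hj.2.trans hj₂.1.symm
  have hobs' : ∀ q ∈ (γ₁.concat γ₂ hxx).x '' Set.Icc 0 (γ₁.concat γ₂ hxx).T, ∀ a ∈ P.obs,
      δ' / 2 ≤ dist q a := by
    rintro _ ⟨t, ht, rfl⟩ a ha
    change 0 ≤ t ∧ t ≤ γ₁.T + γ₂.T at ht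
    change δ' / 2 ≤ dist (γ₁.concatState γ₂ t) a
    rcases le_total t γ₁.T with h | h
    · have := hobs t ⟨ht.1, h⟩ a ha
      rw [Trajectory.concatState, if_pos h]
      linarith
    · rw [Trajectory.concatState_of_ge hxx h]
      have h1 := hobs γ₁.T ⟨γ₁.T_nonneg, le_rfl⟩ a ha
      have h2 := γ₂.dist_start_le (t := t - γ₁.T) ⟨sub_nonneg.2 h, by linarith [ht.2]⟩
      have h3 := dist_triangle (γ₁.x γ₁.T) (γ₂.x (t - γ₁.T)) a
      rw [← hxx] at h2
      have := hl₂.trans_le (min_le_right _ _)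
      linarith
  have hend := (Trajectory.joins_concat hj hj₂)
  have hlength := Trajectory.length_concat hxx
  set γ := γ₁.concat γ₂ hxx
  have hcomp : IsCompact (γ.x '' Set.Icc 0 γ.T) := isCompact_Icc.image_of_continuousOn
    γ.continuousOn_x
  obtain ⟨κ₁, hκ₁, hM⟩ := hcomp.exists_cthickening_subset_open S.isOpen_M
    (Set.image_subset_iff.2 γ.x_mem)
  choose ρ hρ hedge using E.local_defined
  obtain ⟨κ₂, hκ₂, hleb⟩ := lebesgue_number_lemma_of_metric
    (c := fun o : S.M => Metric.ball (o : Euc d) (ρ o o.2)) hcomp (fun _ => Metric.isOpen_ball)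
    (by
      rintro _ ⟨t, ht, rfl⟩
      exact Set.mem_iUnion.2 ⟨⟨γ.x t, γ.x_mem t ht⟩, Metric.mem_ball_self (hρ _ _)⟩)
  obtain ⟨O, hO, hgoal⟩ := P.goal_open
  obtain ⟨κ₃, hκ₃, hball⟩ := Metric.isOpen_iff.1 hO y (by rw [hgoal] at hyg; exact hyg.1)
  -- The four bounds ensure in turn: staying in `M`, steering being defined (a Lebesgue number),
  -- ending in the goal, avoiding obstacles.
  obtain ⟨κ, hκ, hκlt⟩ := exists_between (lt_min (lt_min hκ₁ hκ₂) (lt_min hκ₃ (half_pos hδ')))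
  rw [lt_min_iff, lt_min_iff, lt_min_iff] at hκlt
  have hfree : ∀ q ∈ γ.x '' Set.Icc 0 γ.T, Metric.closedBall q κ ⊆ S.M \ P.obs := by
    intro q hq x hx
    refine ⟨hM ?_, fun hxo => ?_⟩
    · exact Metric.mem_cthickening_of_dist_le x q _ _ hq
        ((Metric.mem_closedBall.1 hx).trans hκlt.1.1.le)
    · have h1 := hobs' q hq x hxo
      rw [Metric.mem_closedBall, dist_comm] at hx
      linarith [hκlt.2.2]
  refine ⟨γ, κ, hκ, hend.1, ?_, ?_, fun q hq => ⟨hfree q hq, fun u hu v hv => ?_⟩⟩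
  · rw [hlength]
    linarith [hl₂.trans_le (min_le_left _ _)]
  · intro x hx
    have hx2 := hfree (γ.x γ.T) ⟨γ.T, ⟨γ.T_nonneg, le_rfl⟩, rfl⟩ (Metric.ball_subset_closedBall hx)
    rw [hgoal]
    refine ⟨hball ?_, subset_closure hx2, hx2.1⟩
    rw [hend.2] at hx
    exact Metric.ball_subset_ball hκlt.2.1.le hx
  · obtain ⟨o, ho⟩ := hleb q hq
    have hsub := (Metric.closedBall_subset_ball hκlt.1.2).trans ho
    exact hedge o o.2 u ⟨(hfree q hq hu).1, hsub hu⟩ v ⟨(hfree q hq hv).1, hsub hv⟩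

theorem exists_walkCost_le (S : DCASystem d m) {G : SimpleGraph (Euc d)} (u : ℕ → Euc d) (K : ℕ)
    (hu : ∀ k < K, u k = u (k + 1) ∨ G.Adj (u k) (u (k + 1))) :
    ∃ w : G.Walk (u 0) (u K), walkCost S w ≤ ∑ k ∈ Finset.range K, S.sdist (u k) (u (k + 1)) := by
  induction K with
  | zero => exact ⟨SimpleGraph.Walk.nil, by simp [walkCost]⟩
  | succ K ih =>
    obtain ⟨w, hw⟩ := ih fun k hk => hu k (by omega)
    rw [Finset.sum_range_succ]
    rcases hu K (by omega) with h | h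
    · rw [← h]
      exact ⟨w, hw.trans le_self_add⟩
    · refine ⟨w.append h.toWalk, ?_⟩
      rw [walkCost, SimpleGraph.Walk.darts_append, List.map_append, List.sum_append]
      refine add_le_add hw ?_
      simp [SimpleGraph.Adj.toWalk]

/-- An optimal edge is no longer than a competitor shorter than `r`, so it stays within `r` of `u`,
inside the room of `p`; the lower ball-box bound puts `u` in `Near`. Equality has to be allowed
since one sample may serve two consecutive chain points. -/
theorem eq_or_roadmap_adj {S : DCASystem d m} {Z : CoordSystem S}
    {aMin aMax σMin θMin : ℝ} (hS : SystemAssumptions S Z aMin aMax σMin θMin)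
    (P : PlanningProblem S) (E : Steering S) {κ r : ℝ} (hr : 0 < r) (hrσ : r ≤ σMin)
    {V : Set (Euc d)} {p u v : Euc d} (hp : HasRoom P E κ p) (hu : u ∈ V) (hv : v ∈ V)
    (hpu : dist p u + r ≤ κ) (huv : S.sdist u v < ENNReal.ofReal r) :
    u = v ∨ (roadmap P Z E aMin V r).Adj u v := by
  by_cases hne : u = v
  · exact Or.inl hne
  have hball : ∀ x, dist u x ≤ r → x ∈ Metric.closedBall p κ := fun x hx => by
    rw [Metric.mem_closedBall, dist_comm]
    linarith [dist_triangle p u x]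
  have hub : u ∈ Metric.closedBall p κ := hball u (by rw [dist_self]; exact hr.le)
  have hvb : v ∈ Metric.closedBall p κ := hball v (DCASystem.dist_lt_of_sdist_lt huv).le
  have huM := (hp.1 hub).1
  have hvM := (hp.1 hvb).1
  obtain ⟨τ, hτ⟩ := hp.2 u hub v hvb
  obtain ⟨hτj, hτopt⟩ := E.optimal u v τ hτ
  obtain ⟨τ', hτ'j, hτ'⟩ := DCASystem.exists_of_sdist_lt huv
  have hlen : τ.length < r := (hτopt τ' hτ'j).trans_lt
    ((ENNReal.ofReal_lt_ofReal_iff hr).1 hτ')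
  refine Or.inr ?_
  rw [roadmap, SimpleGraph.fromRel_adj]
  refine ⟨hne, Or.inr ⟨hv, ⟨⟨hu, hne⟩, hvM, ?_⟩, τ, hτ, fun t ht => ?_⟩⟩
  · rw [S.sdist_comm] at huv
    have h1 := (hS.ballBox ⟨v, hvM⟩ u huM (huv.trans_le (ENNReal.ofReal_le_ofReal hrσ))).1
    have h2 := (ENNReal.ofReal_lt_ofReal_iff hr).1 (h1.trans_lt huv)
    rwa [lt_div_iff₀' hS.aMin_pos]
  · refine (hp.1 (hball _ ?_)).2
    have := τ.dist_start_le ht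
    rw [hτj.1] at this
    exact this.trans hlen.le

/-- If every point of a chain from the initial state to the goal has a sample nearby, then DPRM*
succeeds, with a cost controlled by the chain. -/
theorem dprmCost_le_of_chain {S : DCASystem d m} {Z : CoordSystem S}
    {aMin aMax σMin θMin : ℝ} (hS : SystemAssumptions S Z aMin aMax σMin θMin) (hd : d ≠ 0)
    (P : PlanningProblem S) (E : Steering S) {κ r : ℝ} (hr : 0 < r) (hrσ : r ≤ σMin)
    (hrκ : 2 * r ≤ κ) {p : ℕ → Euc d} {K : ℕ} (hroom : ∀ k, HasRoom P E κ (p k))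
    (h0 : p 0 = P.init) (hgoal : Metric.ball (p K) κ ⊆ P.goal)
    (hstep : ∀ k < K, S.sdist (p k) (p (k + 1)) ≤ ENNReal.ofReal (r / 2))
    {n : ℕ} (ω : Fin n → Euc d) {e : ℕ → ℝ} (he0 : ∀ k, 0 < e k) (he : ∀ k, e k ≤ r / 4)
    (hω : ∀ k ≤ K, ∃ i, S.sdist (p k) (ω i) < ENNReal.ofReal (e k)) :
    dprmCost P Z E aMin r ω ≤
      ENNReal.ofReal (∑ k ∈ Finset.range K, (e k + r / 2 + e (k + 1))) := by
  have hex : ∀ k, ∃ u ∈ vertices P ω, (k = 0 → u = P.init) ∧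
      (k ≤ K → S.sdist (p k) u < ENNReal.ofReal (e k)) := by
    intro k
    rcases eq_or_ne k 0 with rfl | hk
    · refine ⟨P.init, Set.mem_insert _ _, fun _ => rfl, fun _ => ?_⟩
      rw [h0, hS.sdist_self hd P.init_mem.2]
      exact ENNReal.ofReal_pos.2 (he0 0)
    · by_cases hkK : k ≤ K
      · obtain ⟨i, hi⟩ := hω k hkK
        exact ⟨ω i, Set.mem_insert_of_mem _ ⟨i, rfl⟩, fun h => absurd h hk, fun _ => hi⟩
      · exact ⟨P.init, Set.mem_insert _ _, fun h => absurd h hk, fun h => absurd h hkK⟩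
  choose u huV hu0 hud using hex
  have hdist : ∀ k ≤ K, dist (p k) (u k) < r / 4 := fun k hk =>
    (DCASystem.dist_lt_of_sdist_lt (hud k hk)).trans_le (he k)
  -- With `e ≤ r/4` and spacing `r/2` every hop is shorter than `r`.
  have hhop : ∀ k < K, S.sdist (u k) (u (k + 1)) <
      ENNReal.ofReal (e k + r / 2 + e (k + 1)) := by
    intro k hk
    rw [ENNReal.ofReal_add (by linarith [he0 k]) (he0 _).le, ENNReal.ofReal_add (he0 k).le
      (by linarith)]
    refine (S.sdist_triangle _ (p (k + 1)) _).trans_lt ?_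
    refine lt_of_le_of_lt (add_le_add_left ?_ _) (ENNReal.add_lt_add_left ?_ (hud (k + 1) hk))
    · refine (S.sdist_triangle _ (p k) _).trans (add_le_add ?_ (hstep k hk))
      exact (S.sdist_comm _ _).trans_le (hud k hk.le).le
    · exact ENNReal.add_ne_top.2 ⟨ENNReal.ofReal_ne_top, ENNReal.ofReal_ne_top⟩
  have hadj : ∀ k < K, u k = u (k + 1) ∨
      (roadmap P Z E aMin (vertices P ω) r).Adj (u k) (u (k + 1)) := by
    intro k hk
    refine eq_or_roadmap_adj hS P E hr hrσ (hroom k) (huV _) (huV _) ?_ ((hhop k hk).trans_le ?_)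
    · linarith [hdist k hk.le]
    · refine ENNReal.ofReal_le_ofReal ?_
      linarith [he k, he (k + 1)]
  obtain ⟨w, hw⟩ := exists_walkCost_le S u K hadj
  have hgK : u K ∈ P.goal := by
    refine hgoal ?_
    rw [Metric.mem_ball, dist_comm]
    linarith [hdist K le_rfl]
  have h1 : dprmCost P Z E aMin r ω ≤
      graphCost P (roadmap P Z E aMin (vertices P ω) r) (u K) :=
    iInf₂_le (u K) ⟨huV K, hgK⟩
  have h2 : graphCost P (roadmap P Z E aMin (vertices P ω) r) (u K) ≤
      ∑ k ∈ Finset.range K, S.sdist (u k) (u (k + 1)) := by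
    rw [graphCost, ← hu0 0 rfl]
    exact (iInf_le _ w).trans hw
  refine h1.trans (h2.trans ?_)
  rw [ENNReal.ofReal_sum_of_nonneg fun k _ => by linarith [he0 k, he0 (k + 1)]]
  exact Finset.sum_le_sum fun k hk => (hhop k (Finset.mem_range.1 hk)).le

/-! ### Probability that boxes receive no sample. -/

section Sampling

variable {X : Type*} [MeasurableSpace X] (ν : Measure X) [IsProbabilityMeasure ν]

theorem pi_real_forall_notMem_le {B : Set X} (hB : MeasurableSet B) {b : ℝ} (hb : b ≤ ν.real B)
    (n : ℕ) : (Measure.pi fun _ : Fin n => ν).real {ω | ∀ i, ω i ∉ B} ≤ Real.exp (-(n * b)) := by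
  have h : {ω : Fin n → X | ∀ i, ω i ∉ B} = Set.univ.pi fun _ => Bᶜ := by
    ext ω
    simp
  rw [h, Measure.real, Measure.pi_pi, Finset.prod_const, Finset.card_univ, Fintype.card_fin,
    ENNReal.toReal_pow]
  change ν.real Bᶜ ^ n ≤ _
  rw [probReal_compl_eq_one_sub hB, ← mul_neg, Real.exp_nat_mul]
  refine pow_le_pow_left₀ (sub_nonneg.2 measureReal_le_one) ?_ n
  linarith [Real.add_one_le_exp (-b)]

open Classical in
/-- A union bound: with high probability all sets `big k` contain a sample and less than `2q` of the
sets `small k` do not. -/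
theorem pi_real_failure_le {big small : ℕ → Set X} {K : ℕ} (hbig : ∀ k, MeasurableSet (big k))
    (hsmall : ∀ k, MeasurableSet (small k))
    (hdisj : ∀ i j, i + 1 < j → j ≤ K → Disjoint (small i) (small j))
    {b s : ℝ} (hb : ∀ k, b ≤ ν.real (big k)) (hs0 : 0 ≤ s) (hs : ∀ k, s ≤ ν.real (small k))
    (q n : ℕ) :
    (Measure.pi fun _ : Fin n => ν).real
      {ω | ¬ ((∀ k ≤ K, ∃ i, ω i ∈ big k) ∧
        ((Finset.range (K + 1)).filter fun k => ∀ i, ω i ∉ small k).card < 2 * q)} ≤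
      (K + 1) * Real.exp (-(n * b)) + 2 ^ (K + 1) * Real.exp (-(n * (q * s))) := by
  set T : Finset (Finset ℕ) := (Finset.range (K + 1)).powerset.filter fun J =>
    q ≤ J.card ∧ (J : Set ℕ).PairwiseDisjoint small with hT
  have hsub : {ω : Fin n → X | ¬ ((∀ k ≤ K, ∃ i, ω i ∈ big k) ∧
        ((Finset.range (K + 1)).filter fun k => ∀ i, ω i ∉ small k).card < 2 * q)} ⊆
      (⋃ k ∈ Finset.range (K + 1), {ω | ∀ i, ω i ∉ big k}) ∪
      ⋃ J ∈ T, {ω | ∀ i, ω i ∉ ⋃ k ∈ J, small k} := by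
    intro ω hω
    rw [Set.mem_ofPred_eq, not_and_or] at hω
    rcases hω with h | h
    · push Not at h
      obtain ⟨k, hk, hi⟩ := h
      exact Or.inl (Set.mem_biUnion (Finset.mem_coe.2 (Finset.mem_range.2 (Nat.lt_succ_of_le hk)))
        hi)
    · refine Or.inr ?_
      rw [not_lt] at h
      set F := (Finset.range (K + 1)).filter fun k => ∀ i, ω i ∉ small k with hF
      -- Distinct indices of equal parity differ by at least two, so their small sets are disjoint;
      -- one parity class contains at least `q` of the `2q` missed indices.
      have hcard := Finset.card_filter_add_card_filter_not (s := F) (fun k => Even k)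
      have key : ∀ J ⊆ F, q ≤ J.card → (∀ i ∈ J, ∀ j ∈ J, (Even i ↔ Even j)) →
          ω ∈ ⋃ J ∈ T, {ω : Fin n → X | ∀ i, ω i ∉ ⋃ k ∈ J, small k} := by
        intro J hJ hq hpar
        have hlt : ∀ k ∈ J, k ≤ K := fun k hk =>
          Nat.lt_succ_iff.1 (Finset.mem_range.1 (Finset.mem_filter.1 (hJ hk)).1)
        have hne : ∀ i ∈ J, ∀ j ∈ J, i < j → Disjoint (small i) (small j) := by
          intro i hi j hj hij
          refine hdisj i j (lt_of_le_of_ne hij fun h => ?_) (hlt j hj)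
          have := hpar i hi j hj
          rw [← h] at this
          change Even i ↔ Even (i + 1) at this
          rw [Nat.even_add_one] at this
          tauto
        refine Set.mem_biUnion (x := J) ?_ ?_
        · refine Finset.mem_coe.2 (Finset.mem_filter.2 ⟨Finset.mem_powerset.2
            (hJ.trans (Finset.filter_subset _ _)), hq, fun i hi j hj hij => ?_⟩)
          rcases lt_or_gt_of_ne hij with h' | h'
          · exact hne i hi j hj h'
          · exact (hne j hj i hi h').symm
        · intro i hi
          obtain ⟨k, hk, hik⟩ := Set.mem_iUnion₂.1 hi
          exact (Finset.mem_filter.1 (hJ hk)).2 i hik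
      rcases le_or_gt q (F.filter fun k => Even k).card with h' | h'
      · refine key _ (Finset.filter_subset _ _) h' fun i hi j hj => ?_
        exact iff_of_true (Finset.mem_filter.1 hi).2 (Finset.mem_filter.1 hj).2
      · refine key (F.filter fun k => ¬ Even k) (Finset.filter_subset _ _) (by omega)
          fun i hi j hj => ?_
        exact iff_of_false (Finset.mem_filter.1 hi).2 (Finset.mem_filter.1 hj).2
  refine (measureReal_mono hsub).trans ((measureReal_union_le _ _).trans (add_le_add ?_ ?_))
  · refine (measureReal_biUnion_finset_le _ _).trans ?_
    refine (Finset.sum_le_card_nsmul _ _ (Real.exp (-(n * b))) fun k _ =>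
      pi_real_forall_notMem_le ν (hbig k) (hb k) n).trans_eq ?_
    simp
  · refine (measureReal_biUnion_finset_le _ _).trans ?_
    refine (Finset.sum_le_card_nsmul _ _ (Real.exp (-(n * (q * s)))) fun J hJ => ?_).trans ?_
    · rw [hT, Finset.mem_filter] at hJ
      refine pi_real_forall_notMem_le ν (J.measurableSet_biUnion fun k _ => hsmall k) ?_ n
      rw [measureReal_biUnion_finset hJ.2.2 fun k _ => hsmall k]
      calc (q : ℝ) * s ≤ J.card * s :=
            mul_le_mul_of_nonneg_right (Nat.cast_le.2 hJ.2.1) hs0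
        _ = J.card • s := (nsmul_eq_mul _ _).symm
        _ ≤ _ := Finset.card_nsmul_le_sum _ _ _ fun k _ => hs k
    · rw [nsmul_eq_mul]
      refine mul_le_mul_of_nonneg_right ?_ (Real.exp_pos _).le
      have : T.card ≤ 2 ^ (K + 1) := by
        refine (Finset.card_filter_le _ _).trans_eq ?_
        rw [Finset.card_powerset, Finset.card_range]
      exact_mod_cast this

end Sampling

/-! ### Asymptotics of the two failure terms. -/

section Asymptotics

theorem tendsto_log_div_rpow {D : ℕ} (hD : 0 < D) (C : ℝ) :
    Tendsto (fun n : ℕ => C * (Real.log n / n) ^ (1 / (D : ℝ))) atTop (𝓝 0) := by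
  have h1 : Tendsto (fun n : ℕ => Real.log n / n) atTop (𝓝 0) := by
    have := (Real.isLittleO_log_id_atTop.tendsto_div_nhds_zero).comp tendsto_natCast_atTop_atTop
    exact this
  have hpos : (0 : ℝ) < 1 / (D : ℝ) := by positivity
  have h2 := (h1.rpow_const (p := 1 / (D : ℝ)) (Or.inr hpos.le)).const_mul C
  rwa [Real.zero_rpow hpos.ne', mul_zero] at h2

theorem eventually_failure_bound {D : ℕ} (hD : 0 < D) {C₁ C₂ κ a η : ℝ} (hC₁ : 0 < C₁)
    (hC₂ : 0 < C₂) (hκ : 0 < κ) (ha : 0 < a) (r : ℕ → ℝ)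
    (hr : ∀ n : ℕ, r n = C₂ * (Real.log n / n) ^ (1 / (D : ℝ))) :
    ∀ᶠ n : ℕ in atTop, C₁ / r n * Real.exp (-((1 + η) / D * Real.log n)) +
        Real.exp (C₁ / r n) * Real.exp (-(κ / r n * (a * Real.log n))) ≤
      (C₁ / C₂ + 1) * ((n : ℝ) ^ (-(η / (D : ℝ))) * (Real.log n) ^ (-(1 / (D : ℝ)))) := by
  have hlog : Tendsto (fun n : ℕ => Real.log n) atTop atTop :=
    Real.tendsto_log_atTop.comp tendsto_natCast_atTop_atTop
  have hr0 : Tendsto r atTop (𝓝 0) := by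
    rw [funext hr]
    exact tendsto_log_div_rpow hD C₂
  set c := 2 * (|η / D| + 1) / (κ * a) with hc
  have hcpos : 0 < c := by positivity
  filter_upwards [hlog.eventually_ge_atTop (max 1 (2 * C₁ / (κ * a))), eventually_gt_atTop 0,
    hr0.eventually (gt_mem_nhds (inv_pos.2 hcpos))] with n hn hn0 hrn
  have hl1 : 1 ≤ Real.log n := (le_max_left _ _).trans hn
  have hl0 : 0 < Real.log n := zero_lt_one.trans_le hl1
  have hn' : (0 : ℝ) < n := Nat.cast_pos.2 hn0
  have hDpos : (0 : ℝ) < D := Nat.cast_pos.2 hD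
  have hrpos : 0 < r n := by
    rw [hr]
    positivity
  have hexp : ∀ t : ℝ, Real.exp (t * Real.log n) = (n : ℝ) ^ t := fun t => by
    rw [Real.rpow_def_of_pos hn', mul_comm]
  rw [add_mul, one_mul]
  refine add_le_add (le_of_eq ?_) ?_
  · rw [← neg_mul, hexp, hr, Real.div_rpow hl0.le hn'.le, Real.rpow_neg hl0.le,
      show -((1 + η) / (D : ℝ)) = -(η / D) - 1 / D by ring, Real.rpow_sub hn']
    field_simp
  · rw [← Real.exp_add]
    -- Half of the negative exponent absorbs the entropy term `C₁ / r n`, as `log n` is large. The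
    -- other half, as `1 / r n` is large, beats `n ^ (-(η / D) - 1)`, whose spare factor `1 / n`
    -- pays for the logarithm.
    have h1 : C₁ / r n ≤ κ / r n * (a * Real.log n) / 2 := by
      have := (le_max_right _ _).trans hn
      rw [div_le_iff₀ (by positivity)] at this
      rw [div_mul_eq_mul_div, div_div, mul_comm (r n) 2, ← div_div]
      refine div_le_div_of_nonneg_right ?_ hrpos.le
      linarith
    have h2 : (|η / D| + 1) * Real.log n ≤ κ / r n * (a * Real.log n) / 2 := by
      have h3 : c ≤ (r n)⁻¹ := (le_inv_comm₀ hrpos hcpos).1 hrn.le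
      have h4 : (|η / D| + 1) = c * (κ * a) / 2 := by
        rw [hc]
        field_simp
      calc (|η / D| + 1) * Real.log n = c * (κ * a) / 2 * Real.log n := by rw [h4]
        _ ≤ (r n)⁻¹ * (κ * a) / 2 * Real.log n := by gcongr
        _ = _ := by ring
    calc Real.exp (C₁ / r n + -(κ / r n * (a * Real.log n)))
        ≤ Real.exp (-(|η / D| + 1) * Real.log n) := Real.exp_le_exp.2 (by linarith)
      _ ≤ Real.exp ((-(η / D) - 1) * Real.log n) := by
          refine Real.exp_le_exp.2 (mul_le_mul_of_nonneg_right ?_ hl0.le)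
          linarith [le_abs_self (η / D)]
      _ = (n : ℝ) ^ (-(η / (D : ℝ))) * (n : ℝ)⁻¹ := by
          rw [hexp, Real.rpow_sub hn', Real.rpow_one, div_eq_mul_inv]
      _ ≤ _ := by
          refine mul_le_mul_of_nonneg_left ?_ (Real.rpow_nonneg hn'.le _)
          rw [Real.rpow_neg hl0.le]
          refine inv_anti₀ (by positivity) ?_
          calc (Real.log n) ^ (1 / (D : ℝ)) ≤ (Real.log n) ^ (1 : ℝ) := by
                refine Real.rpow_le_rpow_of_exponent_le hl1 ?_
                rw [div_le_one hDpos]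
                exact_mod_cast hD
            _ = Real.log n := Real.rpow_one _
            _ ≤ n := (Real.log_le_sub_one_of_pos hn').trans (by linarith)

end Asymptotics

/-! ### The failure bound for a fixed sample size. -/

theorem PlanningProblem.measurableSet_free {S : DCASystem d m} (P : PlanningProblem S) :
    MeasurableSet P.free :=
  isClosed_closure.measurableSet.inter S.isOpen_M.measurableSet

theorem PlanningProblem.diff_subset_free {S : DCASystem d m} (P : PlanningProblem S) :
    S.M \ P.obs ⊆ P.free :=
  fun _ hx => ⟨subset_closure hx, hx.1⟩

/-- The factor `2 ^ d` of the volume is discarded; the constant in the radius does not need it. -/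
theorem PrivilegedCoords.le_cond_box {S : DCASystem d m} {x₀ : Euc d} (c : PrivilegedCoords S x₀)
    (P : PlanningProblem S) {ρ : ℝ} (hρ : 0 < ρ) (hsub : c.box ρ ⊆ P.free) :
    ρ ^ S.homDim x₀ / (volume P.free).toReal ≤
      (ProbabilityTheory.cond (volume : Measure (Euc d)) P.free).real (c.box ρ) := by
  rw [Measure.real, ProbabilityTheory.cond_apply P.measurableSet_free, Set.inter_eq_self_of_subset_right
    hsub, c.volume_box hρ, ENNReal.toReal_mul, ENNReal.toReal_inv, ENNReal.toReal_ofReal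
    (by positivity), div_eq_inv_mul]
  refine mul_le_mul_of_nonneg_left ?_ (by positivity)
  exact le_mul_of_one_le_left (by positivity) (one_le_pow₀ one_le_two)

theorem isProbabilityMeasure_sampleFree {S : DCASystem d m} (P : PlanningProblem S)
    (hfin : volume P.free ≠ ⊤) (hfree : volume P.free ≠ 0) (n : ℕ) :
    IsProbabilityMeasure (sampleFree P n) := by
  have : IsProbabilityMeasure (ProbabilityTheory.cond (volume : Measure (Euc d)) P.free) :=
    ProbabilityTheory.cond_isProbabilityMeasure_of_finite hfree hfin
  exact Measure.pi.instIsProbabilityMeasure _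

/-- In the cost threshold, `K * (r / 2)` is the chain itself. Each deviation counts for two hops: at
most `β * r` at every point, plus up to `r / 4` at fewer than `2 * q` bad points, totalling `q * r`.
-/
theorem exists_failure_bound {S : DCASystem d m} {Z : CoordSystem S}
    {aMin aMax σMin θMin : ℝ} (hS : SystemAssumptions S Z aMin aMax σMin θMin) (hd : d ≠ 0)
    (P : PlanningProblem S) (hfin : volume P.free ≠ ⊤) (hfree : volume P.free ≠ 0)
    (E : Steering S) (γ : Trajectory S) {κ r β : ℝ}
    (h0 : γ.x 0 = P.init) (hgoal : Metric.ball (γ.x γ.T) κ ⊆ P.goal)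
    (hroom : ∀ q ∈ γ.x '' Set.Icc 0 γ.T, HasRoom P E κ q)
    (hr : 0 < r) (hrσ : r ≤ σMin) (hrκ : 2 * r ≤ κ) (hβ : 0 < β) (hβ' : β ≤ 1 / 4) (q n : ℕ) :
    ∃ K : ℕ, (K : ℝ) ≤ 2 * γ.length / r + 1 ∧
      (sampleFree P n).real {ω | ENNReal.ofReal (K * (r / 2) + 2 * ((K + 1) * (β * r)) + q * r) <
        dprmCost P Z E aMin r ω} ≤
      (K + 1) * Real.exp (-(n * ((r / (4 * aMax)) ^ S.homDim P.init / (volume P.free).toReal))) +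
        2 ^ (K + 1) * Real.exp
          (-(n * (q * ((β * r / aMax) ^ S.homDim P.init / (volume P.free).toReal)))) := by
  classical
  have hA := hS.aMax_pos
  obtain ⟨p', hp'0, hp'N, hp'C, hp'step⟩ := γ.exists_chain (half_pos hr)
  obtain ⟨K, hKN, p, hp0, hpK, hpC, hstep, hfar⟩ := exists_minimal_chain
    (fun x y => S.sdist x y ≤ ENNReal.ofReal (r / 2)) (γ.x '' Set.Icc 0 γ.T)
    (N := ⌈γ.length / (r / 2)⌉₊) hp'C fun k _ => hp'step k
  rw [hp'0, h0] at hp0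
  rw [hp'N] at hpK
  have hroom' := fun k => hroom _ (hpC k)
  have hpM : ∀ k, p k ∈ S.M := fun k =>
    ((hroom' k).1 (Metric.mem_closedBall_self (by linarith))).1
  have hhom : ∀ k, S.homDim (p k) = S.homDim P.init := by
    intro k
    obtain ⟨t, ht, htk⟩ := hpC k
    rw [← htk, ← h0]
    exact hS.homDim_eq γ ht ⟨le_rfl, γ.T_nonneg⟩
  have hbox : ∀ k ρ, 0 < ρ → ρ ≤ r / 4 → ∀ x ∈ (Z ⟨p k, hpM k⟩).box (ρ / aMax),
      S.sdist (p k) x < ENNReal.ofReal ρ := by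
    intro k ρ hρ hρr x hx
    have hm : aMax * (ρ / aMax) = ρ := mul_div_cancel₀ _ hA.ne'
    have := hS.box_subset hd ⟨p k, hpM k⟩ (div_pos hρ hA) (by linarith) ((by
      refine (Metric.closedBall_subset_closedBall ?_).trans ((hroom' k).1.trans Set.sdiff_subset)
      linarith)) hx
    rw [hm] at this
    exact this.2
  have hboxfree : ∀ k ρ, 0 < ρ → ρ ≤ r / 4 → (Z ⟨p k, hpM k⟩).box (ρ / aMax) ⊆ P.free := by
    intro k ρ hρ hρr x hx
    refine P.diff_subset_free ((hroom' k).1 ?_)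
    rw [Metric.mem_closedBall, dist_comm]
    have := DCASystem.dist_lt_of_sdist_lt (hbox k ρ hρ hρr x hx)
    linarith
  have hr4 : 0 < r / 4 := by positivity
  have hβr : 0 < β * r := mul_pos hβ hr
  have hβr' : β * r ≤ r / 4 := by nlinarith
  set big : ℕ → Set (Euc d) := fun k => (Z ⟨p k, hpM k⟩).box (r / 4 / aMax) with hbig
  set small : ℕ → Set (Euc d) := fun k => (Z ⟨p k, hpM k⟩).box (β * r / aMax) with hsmall
  have : IsProbabilityMeasure (ProbabilityTheory.cond (volume : Measure (Euc d)) P.free) :=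
    ProbabilityTheory.cond_isProbabilityMeasure_of_finite hfree hfin
  have := isProbabilityMeasure_sampleFree P hfin hfree n
  have hprob := pi_real_failure_le (ProbabilityTheory.cond (volume : Measure (Euc d)) P.free)
    (big := big) (small := small) (K := K)
    (b := (r / (4 * aMax)) ^ S.homDim P.init / (volume P.free).toReal)
    (s := (β * r / aMax) ^ S.homDim P.init / (volume P.free).toReal)
    (fun k => ((Z ⟨p k, hpM k⟩).isOpen_box _).measurableSet)
    (fun k => ((Z ⟨p k, hpM k⟩).isOpen_box _).measurableSet)
    -- A common point would put the centres within `2 * β * r ≤ r / 2`, which minimality forbids for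
    -- non-adjacent indices.
    (fun i j hij hj => Set.disjoint_left.2 fun x hxi hxj => hfar i j hij hj (by
      refine (S.sdist_triangle _ x _).trans ((add_le_add (hbox i _ hβr hβr' x hxi).le
        ((S.sdist_comm _ _).trans_le (hbox j _ hβr hβr' x hxj).le)).trans ?_)
      rw [← ENNReal.ofReal_add hβr.le hβr.le]
      exact ENNReal.ofReal_le_ofReal (by linarith)))
    (fun k => by
      have := (Z ⟨p k, hpM k⟩).le_cond_box P (div_pos hr4 hA) (hboxfree k _ hr4 le_rfl)
      rw [hhom] at this
      rwa [← div_div])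
    (by positivity)
    (fun k => by
      have := (Z ⟨p k, hpM k⟩).le_cond_box P (div_pos hβr hA) (hboxfree k _ hβr hβr')
      rwa [hhom] at this) q n
  refine ⟨K, ?_, (measureReal_mono ?_).trans hprob⟩
  · have h1 : (K : ℝ) ≤ ⌈γ.length / (r / 2)⌉₊ := Nat.cast_le.2 hKN
    have h2 := (Nat.ceil_lt_add_one (div_nonneg γ.length_nonneg (half_pos hr).le)).le
    refine h1.trans (h2.trans_eq ?_)
    field_simp
  · intro ω hω
    rw [Set.mem_ofPred_eq] at hω
    refine fun hgood => (not_le.2 hω) ?_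
    obtain ⟨hgb, hgs⟩ := hgood
    set e : ℕ → ℝ := fun k => if ∀ i, ω i ∉ small k then r / 4 else β * r with he
    have he0 : ∀ k, 0 < e k := fun k => by
      simp only [he]
      split_ifs <;> assumption
    refine (dprmCost_le_of_chain hS hd P E hr hrσ hrκ hroom' hp0 (hpK ▸ hgoal) hstep ω he0
      (fun k => ?_) fun k hk => ?_).trans (ENNReal.ofReal_le_ofReal ?_)
    · simp only [he]
      split_ifs
      · exact le_rfl
      · exact hβr'
    · simp only [he]
      split_ifs with h
      · obtain ⟨i, hi⟩ := hgb k hk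
        exact ⟨i, hbox k _ hr4 le_rfl _ hi⟩
      · push Not at h
        obtain ⟨i, hi⟩ := h
        exact ⟨i, hbox k _ hβr hβr' _ hi⟩
    · have h1 : ∑ k ∈ Finset.range (K + 1), e k ≤ (K + 1) * (β * r) + 2 * q * (r / 4) := by
        have h2 : ∀ k, e k ≤ β * r + if ∀ i, ω i ∉ small k then r / 4 else 0 := fun k => by
          simp only [he]
          split_ifs <;> linarith
        refine (Finset.sum_le_sum fun k _ => h2 k).trans ?_
        rw [Finset.sum_add_distrib, ← Finset.sum_filter, Finset.sum_const, Finset.sum_const,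
          Finset.card_range, nsmul_eq_mul, nsmul_eq_mul]
        push_cast
        refine add_le_add le_rfl (mul_le_mul_of_nonneg_right ?_ hr4.le)
        exact_mod_cast hgs.le
      have h3 : ∑ k ∈ Finset.range K, e k ≤ ∑ k ∈ Finset.range (K + 1), e k := by
        rw [Finset.sum_range_succ]
        linarith [he0 K]
      have h4 : ∑ k ∈ Finset.range K, e (k + 1) ≤ ∑ k ∈ Finset.range (K + 1), e k := by
        rw [Finset.sum_range_succ']
        linarith [he0 0]
      rw [Finset.sum_add_distrib, Finset.sum_add_distrib, Finset.sum_const, Finset.card_range,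
        nsmul_eq_mul]
      linarith

theorem dprmCost_eq_zero_of_init_mem {S : DCASystem d m} (P : PlanningProblem S) (Z : CoordSystem S)
    (E : Steering S) (aMin r : ℝ) (h : P.init ∈ P.goal) {n : ℕ} (ω : Fin n → Euc d) :
    dprmCost P Z E aMin r ω = 0 := by
  refine le_antisymm ((iInf₂_le P.init ⟨Set.mem_insert _ _, h⟩).trans
    ((iInf_le _ SimpleGraph.Walk.nil).trans ?_)) zero_le
  simp [walkCost]

end DPRM

/-! ### Choice of constants and conclusion. -/

theorem mainTheorem4 {d m : ℕ} (S : DPRM.DCASystem d m) (Z : DPRM.CoordSystem S)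
    (aMin aMax σMin θMin : ℝ) (hS : DPRM.SystemAssumptions S Z aMin aMax σMin θMin)
    (P : DPRM.PlanningProblem S) (hfin : volume P.free ≠ ⊤)
    (ξ : ℝ) (hξ : 0 < ξ) (hgoal : P.GoalRegular ξ)
    (hinit : P.init ∈ closure P.goal → P.init ∈ P.goal)
    (xStar : DPRM.Trajectory S) (hopt : P.IsOptimal xStar)
    (δ : ℝ) (hδ : 0 < δ) (hclear : P.WeakClearance δ xStar)
    (E : DPRM.Steering S) (η : ℝ) (hη : 0 ≤ η) (ε : ℝ) (hε : 0 < ε) :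
    (fun n : ℕ => (DPRM.sampleFree P n).real
        {ω | ENNReal.ofReal ((1 + ε) * xStar.length) <
          DPRM.dprmCost P Z E aMin (DPRM.radius P aMax η n) ω})
      =O[atTop] fun n : ℕ => (n : ℝ) ^ (-(η / (S.homDim P.init : ℝ))) *
        (Real.log n) ^ (-(1 / (S.homDim P.init : ℝ))) := by
  -- Here the empty path costs `0`. Outside this case `d ≠ 0` and `c* > 0`, so `(1 + ε) c*` leaves
  -- genuine slack.
  by_cases hg : P.init ∈ P.goal
  · simp only [DPRM.dprmCost_eq_zero_of_init_mem P Z E aMin _ hg, not_lt_zero, Set.ofPred_false,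
      measureReal_empty]
    exact isBigO_zero _ _
  have hfeas := hopt.1
  have hd : d ≠ 0 := by
    rintro rfl
    obtain ⟨z, hz⟩ := closure_nonempty_iff.1 ⟨_, hfeas.2.2⟩
    exact hg (Subsingleton.elim z P.init ▸ hz)
  have hpos : 0 < xStar.length := by
    refine xStar.length_nonneg.lt_of_ne fun h => hg (hinit ?_)
    have h1 := xStar.dist_start_le ⟨xStar.T_nonneg, le_rfl⟩
    rw [← h, dist_le_zero, hfeas.2.1] at h1
    rw [h1]
    exact hfeas.2.2
  obtain ⟨γ, κ, hκ, h0, hlen, hγgoal, hroom⟩ := DPRM.exists_reference_trajectory hS hd P E hfeas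
    hclear (show xStar.length < (1 + ε) * xStar.length by nlinarith)
  have hinitM : P.init ∈ S.M := P.init_mem.2
  have hD := hS.homDim_pos hd hinitM
  have hA := hS.aMax_pos
  have hfree : volume P.free ≠ 0 := by
    have h1 : Metric.ball P.init κ ⊆ P.free := by
      rw [← h0]
      exact Metric.ball_subset_closedBall.trans
        ((hroom _ ⟨0, ⟨le_rfl, γ.T_nonneg⟩, rfl⟩).1.trans P.diff_subset_free)
    exact ((Metric.measure_ball_pos volume _ hκ).trans_le (measure_mono h1)).ne'
  have hμ : 0 < (volume P.free).toReal := ENNReal.toReal_pos hfree hfin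
  set D := S.homDim P.init with hDdef
  set μ := (volume P.free).toReal with hμdef
  set L := γ.length with hL
  have hL0 : 0 ≤ L := γ.length_nonneg
  set c := (1 + ε) * xStar.length with hc
  set g := c - L with hgdef
  have hg0 : 0 < g := sub_pos.2 hlen
  -- Since `K * r ≤ 2 * L + r` and `r < 1`, this makes the small deviations cost at most `g / 4` in
  -- total.
  obtain ⟨β, hβ, hβlt⟩ := exists_between (show 0 < min (1 / 4) (g / (16 * (L + 1))) by positivity)
  have hβ4 : β ≤ 1 / 4 := (hβlt.trans_le (min_le_left _ _)).le
  have hβL : β * (16 * (L + 1)) ≤ g := by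
    rw [← le_div_iff₀ (by positivity)]
    exact (hβlt.trans_le (min_le_right _ _)).le
  have hDpos : (0 : ℝ) < D := Nat.cast_pos.2 hD
  set C₂ := 4 * aMax * (1 + η) ^ (1 / (D : ℝ)) * (μ / D) ^ (1 / (D : ℝ)) with hC₂
  have hC₂pos : 0 < C₂ := by positivity
  set r : ℕ → ℝ := fun n => DPRM.radius P aMax η n with hr
  have hrC : ∀ n : ℕ, r n = C₂ * (Real.log n / n) ^ (1 / (D : ℝ)) := fun n => rfl
  have hr0 : Tendsto r atTop (𝓝 0) := DPRM.tendsto_log_div_rpow hD C₂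
  -- The small box is the big one with its parameter scaled by `4 * β`, hence the factor `(4 * β) ^
  -- D`.
  set a := (4 * β) ^ D * ((1 + η) / D) with ha
  have hapos : 0 < a := by positivity
  refine IsBigO.of_bound ((2 * L + 2) / C₂ + 1) ?_
  filter_upwards [DPRM.eventually_failure_bound (η := η) hD (show 0 < 2 * L + 2 by positivity)
    hC₂pos (show 0 < g / 4 by positivity) hapos r hrC, eventually_ge_atTop 3,
    hr0.eventually (gt_mem_nhds hS.σMin_pos), hr0.eventually (gt_mem_nhds (half_pos hκ)),
    hr0.eventually (gt_mem_nhds (show 0 < g / 16 by positivity)),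
    hr0.eventually (gt_mem_nhds zero_lt_one)] with n hn hn3 hrσ hrκ hrg hr1
  have hn1 : (1 : ℝ) < n := by exact_mod_cast (show 1 < n by omega)
  have hlog : 0 < Real.log n := Real.log_pos hn1
  have hrpos : 0 < r n := by
    rw [hrC]
    positivity
  -- Bad points may use about a quarter of the gap; the lower bound on `q` drives the
  -- superpolynomial decay.
  obtain ⟨q, hq1, hq2⟩ : ∃ q : ℕ, g / 4 / r n ≤ q ∧ q * r n ≤ g / 4 + r n := by
    refine ⟨⌈g / 4 / r n⌉₊, Nat.le_ceil _, ?_⟩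
    have := (Nat.ceil_lt_add_one (show 0 ≤ g / 4 / r n by positivity)).le
    calc _ ≤ (g / 4 / r n + 1) * r n := mul_le_mul_of_nonneg_right this hrpos.le
      _ = _ := by field_simp
  obtain ⟨K, hK, hprob⟩ := DPRM.exists_failure_bound hS hd P hfin hfree E γ h0 hγgoal hroom hrpos
    hrσ.le (by linarith) hβ hβ4 q n
  have hKr : K * r n ≤ 2 * L + r n := by
    calc _ ≤ (2 * L / r n + 1) * r n := mul_le_mul_of_nonneg_right hK hrpos.le
      _ = _ := by field_simp
  have hK1 : (K : ℝ) + 1 ≤ (2 * L + 2) / r n := by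
    rw [le_div_iff₀ hrpos]
    linarith
  have hcost : K * (r n / 2) + 2 * ((K + 1) * (β * r n)) + q * r n ≤ c := by
    have h1 : (K + 1) * (β * r n) ≤ g / 8 := by
      calc (K + 1) * (β * r n) = β * (K * r n + r n) := by ring
        _ ≤ β * (2 * (L + 1)) := mul_le_mul_of_nonneg_left (by linarith) hβ.le
        _ ≤ g / 8 := by linarith
    linarith
  have hrD : (r n) ^ D = (4 * aMax) ^ D * ((1 + η) * (μ / D) * (Real.log n / n)) := by
    rw [hrC, hC₂]
    simp only [mul_pow, one_div]
    rw [Real.rpow_inv_natCast_pow (by positivity) hD.ne',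
      Real.rpow_inv_natCast_pow (by positivity) hD.ne',
      Real.rpow_inv_natCast_pow (by positivity) hD.ne']
    ring
  have hb : n * ((r n / (4 * aMax)) ^ D / μ) = (1 + η) / D * Real.log n := by
    rw [div_pow, hrD]
    field_simp
  have hs : n * ((β * r n / aMax) ^ D / μ) = a * Real.log n := by
    rw [div_pow, mul_pow, hrD, ha]
    simp only [mul_pow]
    field_simp
  rw [Real.norm_of_nonneg measureReal_nonneg, Real.norm_of_nonneg (by positivity)]
  refine le_trans ?_ hn
  refine (measureReal_mono (fun ω hω => ?_) ?_).trans (hprob.trans (add_le_add ?_ ?_))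
  · exact (ENNReal.ofReal_le_ofReal hcost).trans_lt hω
  · have := DPRM.isProbabilityMeasure_sampleFree P hfin hfree n
    exact measure_ne_top _ _
  · rw [hb]
    exact mul_le_mul_of_nonneg_right hK1 (Real.exp_pos _).le
  · refine mul_le_mul ?_ (Real.exp_le_exp.2 (neg_le_neg ?_)) (Real.exp_pos _).le (Real.exp_pos _).le
    · calc (2 : ℝ) ^ (K + 1) ≤ Real.exp 1 ^ (K + 1) :=
            pow_le_pow_left₀ zero_le_two (by linarith [Real.add_one_le_exp 1]) _
        _ = Real.exp (K + 1) := by rw [← Real.exp_nat_mul]; simp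
        _ ≤ _ := Real.exp_le_exp.2 hK1
    · calc g / 4 / r n * (a * Real.log n) ≤ q * (a * Real.log n) :=
            mul_le_mul_of_nonneg_right hq1 (by positivity)
        _ = _ := by rw [← hs]; ring
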